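/- **Theorem (GNS for algebraic cross-ratios).** For a set $Y$ let $Y^{(4)}\subset Y^4$ be the set of quadruples of which at least three entries are distinct. An *abstract cross-ratio* on a topological space $Y$ is a continuous function $R\colon Y^{(4)}\to[0,\infty]$ such that, for all quadruples in $Y^{(4)}$, - $R(x,x',y,y')=R(y,y',x,x')=R(x',x,y',y)$, - $R(x,x',y,y')=R(y,x',x,y')^{-1}=R(x,y',y,x')^{-1}$, - $R(x,y,x',y')=R(x,y,x'',y')\,R(x'',y,x',y')$ whenever the three quadruples are in $Y^{(4)}$ and the product is not of the indeterminate form $0\cdot\infty$ or $\infty\cdot 0$, - $R(x,x',y,y')=0$ if and only if $x=x'$ or $y=y'$; $R(x,x',y,y')=\infty$ if and only if $x=y'$ or $y=x'$. It is *algebraic* if moreover, for every triple of distinct points of $Y$, denoted $0,1,\infty$, the kernel $K$ on $Y\setminus\{\infty\}$ given by $K(x,x)=0$ and, for $x\neq y$, $K(x,y)=\big(R(x,y,0,\infty)\,R(y,0,1,\infty)\big)^2$ (where for $y=0$ the product is read as $R(x,0,1,\infty)$) is conditionally of negative type: it is symmetric, and $\sum_{i,j}\lambda_i\lambda_jK(x_i,x_j)\le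 0$ for all finite families of points $x_i\in Y\setminus\{\infty\}$ and real numbers $\lambda_i$ with $\sum_i\lambda_i=0$. For a cardinal $\kappa$ let $\mathbf H^\kappa$ be the real hyperbolic space of dimension $\kappa$, i.e. the upper sheet $\{x_0^2-\|x'\|^2=1,\ x_0>0\}$ of the hyperboloid in $\mathbb R\oplus\ell^2(\kappa)$ with $\cosh d(x,y)=x_0y_0-\langle x',y'\rangle$. Let $\partial\mathbf H^\kappa$ be its Gromov boundary with its usual topology, and let $$[a,b;c,d]=\frac{d_o(a,b)\,d_o(c,d)}{d_o(a,d)\,d_o(c,b)}\in[0,\infty],\qquad d_o(\xi,\eta)=e^{-(\xi\mid\eta)_o},$$ be the boundary cross-ratio on $(\partial\mathbf H^\kappa)^{(4)}$; it does not depend on $o\in\mathbf H^\kappa$. A subset $A\subset\partial\mathbf H^\kappa$ is *total* if the only closed totally geodesic subspace of $\mathbf H^\kappa$ containing all geodesics between points of $A$ is $\mathbf H^\kappa$ itself. Distance-preserving maps are understood to be extended to the Gromov boundaries. Let $Y$ be a topological space with at least four points and let $R$ be an algebraic cross-ratio on $Y$. 1. There are a cardinal $\kappa$ and a continuous map $f\colon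 Y\to\partial\mathbf H^\kappa$ with total image such that $[f(x^-),f(x^+);f(y^-),f(y^+)]=R(x^-,x^+,y^-,y^+)$ for all $(x^-,x^+,y^-,y^+)\in Y^{(4)}$. 2. If $f_1\colon Y\to\partial\mathbf H^{\kappa_1}$ and $f_2\colon Y\to\partial\mathbf H^{\kappa_2}$ are two such maps, then $\kappa_1=\kappa_2$ and there is a unique isometry $\varphi\colon\mathbf H^{\kappa_1}\to\mathbf H^{\kappa_2}$ with $f_2=\varphi\circ f_1$; it is bijective, and is unique among all distance-preserving maps. 3. If a group $\Gamma$ acts on $Y$ preserving $R$, then for every such $f\colon Y\to\partial\mathbf H^\kappa$ there is a homomorphism $\rho\colon\Gamma\to\operatorname{Isom}(\mathbf H^\kappa)$ such that $f(\gamma y)=\rho(\gamma)f(y)$ for all $\gamma\in\Gamma$ and $y\in Y$. -/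

import Mathlib

open Filter Topology
open scoped ENNReal

universe u v

noncomputable section

/-! ## Gromov boundary, visual metametric and cross-ratio of a metric space -/

section GromovBoundary

variable {X : Type*} [MetricSpace X]

/-- The Gromov product `(x | y)_o`. -/
def gromovProduct (o x y : X) : ℝ := (dist o x + dist o y - dist x y) / 2

/-- The sequence `s` converges to infinity: `(s m | s n)_o → ∞` as `m, n → ∞`. -/
def ConvergesToInfinity (s : ℕ → X) : Prop :=
  ∀ o : X, Tendsto (fun p : ℕ × ℕ => gromovProduct o (s p.1) (s p.2)) atTop atTop

variable (X) in
/-- The sequences in `X` converging to infinity. -/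
def InfinitySeq : Type _ := {s : ℕ → X // ConvergesToInfinity s}

/-- Equivalence of sequences converging to infinity: `(s m | t n)_o → ∞` as `m, n → ∞`. -/
def InfinitySeq.Equivalent (s t : InfinitySeq X) : Prop :=
  ∀ o : X, Tendsto (fun p : ℕ × ℕ => gromovProduct o (s.1 p.1) (t.1 p.2)) atTop atTop

variable (X) in
/-- The Gromov boundary `∂X`: classes of sequences converging to infinity. (In a Gromov-hyperbolic
space `InfinitySeq.Equivalent` is an equivalence relation, so that this quotient is the set of its
classes.) -/
def GromovBoundary : Type _ := Quot (InfinitySeq.Equivalent (X := X))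

/-- The boundary point which is the limit of a sequence converging to infinity. -/
def InfinitySeq.limit (s : InfinitySeq X) : GromovBoundary X := Quot.mk _ s

/-- The Gromov product `(ξ | η)_o ∈ [0, ∞]` of two boundary points: the infimum of
`liminf (s m | t n)_o` over all sequences `s → ξ` and `t → η`. (In a strongly hyperbolic space these
lower limits are limits and do not depend on the sequences: this is the continuous extension of
the Gromov product to the boundary.) -/
def boundaryGromovProduct (o : X) (ξ η : GromovBoundary X) : ℝ≥0∞ :=
  ⨅ (s : InfinitySeq X) (t : InfinitySeq X) (_ : s.limit = ξ) (_ : t.limit = η),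
    liminf (fun p : ℕ × ℕ => ENNReal.ofReal (gromovProduct o (s.1 p.1) (t.1 p.2))) atTop

/-- The topology of `∂X`: the sets `{η | (ξ | η)_o > r}`, `r < ∞`, are a basis of neighbourhoods
of `ξ`. -/
instance GromovBoundary.instTopologicalSpace : TopologicalSpace (GromovBoundary X) where
  IsOpen U := ∀ ξ ∈ U, ∀ o : X, ∃ r : ℝ≥0∞, r < ∞ ∧
    ∀ η : GromovBoundary X, r < boundaryGromovProduct o ξ η → η ∈ U
  isOpen_univ := fun _ _ _ => ⟨0, ENNReal.zero_lt_top, fun _ _ => Set.mem_univ _⟩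
  isOpen_inter := by
    intro U V hU hV ξ hξ o
    obtain ⟨r, hr, h⟩ := hU ξ hξ.1 o
    obtain ⟨r', hr', h'⟩ := hV ξ hξ.2 o
    exact ⟨max r r', max_lt hr hr', fun η hη =>
      ⟨h η (lt_of_le_of_lt (le_max_left _ _) hη), h' η (lt_of_le_of_lt (le_max_right _ _) hη)⟩⟩
  isOpen_sUnion := by
    intro S hS ξ hξ o
    obtain ⟨U, hU, hξU⟩ := hξ
    obtain ⟨r, hr, h⟩ := hS U hU ξ hξU o
    exact ⟨r, hr, fun η hη => ⟨U, hU, h η hη⟩⟩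

/-- The visual distance `d_o(ξ, η) = exp (-(ξ | η)_o)` on the boundary, with `exp (-∞) = 0`. -/
def visualDist (o : X) (ξ η : GromovBoundary X) : ℝ≥0∞ :=
  EReal.exp (-(boundaryGromovProduct o ξ η : EReal))

/-- The boundary cross-ratio
`[a, b; c, d] = (d_o(a, b) * d_o(c, d)) / (d_o(a, d) * d_o(c, b)) ∈ [0, ∞]`, used for quadruples of
boundary points of which at least three are distinct. -/
def boundaryCrossRatio (o : X) (a b c d : GromovBoundary X) : ℝ≥0∞ :=
  (visualDist o a b * visualDist o c d) / (visualDist o a d * visualDist o c b)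

/-- The sequence `s` converges to the boundary point `ξ`. -/
def ConvergesToBoundary (s : ℕ → X) (ξ : GromovBoundary X) : Prop :=
  ∃ h : ConvergesToInfinity s, InfinitySeq.limit ⟨s, h⟩ = ξ

/-- `γ` is a bi-infinite geodesic from `ξ` to `η`. -/
def IsGeodesicLine (γ : ℝ → X) (ξ η : GromovBoundary X) : Prop :=
  Isometry γ ∧ ConvergesToBoundary (fun n : ℕ => γ (-(n : ℝ))) ξ ∧
    ConvergesToBoundary (fun n : ℕ => γ (n : ℝ)) η

/-- `S` is a totally geodesic (and geodesically complete) subspace: it contains every bi-infinite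
geodesic through any two of its points. -/
def IsTotallyGeodesic (S : Set X) : Prop :=
  ∀ γ : ℝ → X, Isometry γ → ∀ a b : ℝ, a ≠ b → γ a ∈ S → γ b ∈ S → ∀ r : ℝ, γ r ∈ S

/-- A set `A` of boundary points is total when the only closed totally geodesic subspace containing
all geodesics between points of `A` is the whole space. -/
def IsTotalBoundarySet (A : Set (GromovBoundary X)) : Prop :=
  ∀ S : Set X, IsClosed S → IsTotallyGeodesic S →
    (∀ γ : ℝ → X, ∀ ξ ∈ A, ∀ η ∈ A, IsGeodesicLine γ ξ η → ∀ r : ℝ, γ r ∈ S) →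
    S = Set.univ

theorem gromovProduct_base_change (o o' x y : X) :
    gromovProduct o x y - dist o o' ≤ gromovProduct o' x y := by
  unfold gromovProduct
  have h₁ := dist_triangle o o' x
  have h₂ := dist_triangle o o' y
  linarith

/-- The image under a distance-preserving map of a sequence converging to infinity. -/
def InfinitySeq.map {Z : Type*} [MetricSpace Z] (φ : X → Z) (hφ : Isometry φ)
    (s : InfinitySeq X) : InfinitySeq Z :=
  ⟨fun n => φ (s.1 n), fun o => by
    have h := s.2 (s.1 0)
    refine tendsto_atTop_mono (fun p => gromovProduct_base_change (φ (s.1 0)) o _ _) ?_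
    simp only [gromovProduct, hφ.dist_eq]
    exact tendsto_atTop_add_const_right _ _ h⟩

/-- The extension to the Gromov boundaries of a distance-preserving map `φ`, which sends the limit
of a sequence `s` to the limit of `φ ∘ s`. -/
def boundaryMap {Z : Type*} [MetricSpace Z] (φ : X → Z) (hφ : Isometry φ) :
    GromovBoundary X → GromovBoundary Z :=
  Quot.map (InfinitySeq.map φ hφ) (by
    intro s t hst o
    refine tendsto_atTop_mono (fun p => gromovProduct_base_change (φ (s.1 0)) o _ _) ?_
    simp only [gromovProduct, InfinitySeq.map, hφ.dist_eq]
    exact tendsto_atTop_add_const_right _ _ (hst (s.1 0)))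

end GromovBoundary

/-! ## The real algebraic hyperbolic spaces -/

section Hyperboloid

variable (E : Type*) [NormedAddCommGroup E] [InnerProductSpace ℝ E]

/-- The upper sheet `{x | x₀² - ‖x'‖² = 1, x₀ > 0}` of the hyperboloid in the Minkowski space
`ℝ ⊕ E`. -/
@[ext] structure Hyperboloid where
  time : ℝ
  space : E
  time_pos : 0 < time
  form_eq_one : time ^ 2 - ‖space‖ ^ 2 = 1

variable {E}

namespace Hyperboloid

/-- The Minkowski form `⟨x, y⟩ = x₀ y₀ - ⟪x', y'⟫`. -/
def form (x y : Hyperboloid E) : ℝ := x.time * y.time - inner ℝ x.space y.space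

theorem form_comm (x y : Hyperboloid E) : form x y = form y x := by
  unfold form
  rw [real_inner_comm, mul_comm]

theorem form_self (x : Hyperboloid E) : form x x = 1 := by
  unfold form
  rw [real_inner_self_eq_norm_sq, ← pow_two, x.form_eq_one]

theorem one_le_form (x y : Hyperboloid E) : 1 ≤ form x y := by
  unfold form
  have h := real_inner_le_norm x.space y.space
  have hx := x.form_eq_one
  have hy := y.form_eq_one
  have hp : 0 < x.time * y.time := mul_pos x.time_pos y.time_pos
  have h0 : 0 ≤ ‖x.space‖ * ‖y.space‖ := by positivity
  have key : 1 + ‖x.space‖ * ‖y.space‖ ≤ x.time * y.time := by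
    refine le_of_sq_le_sq ?_ hp.le
    have e : (x.time * y.time) ^ 2 = (1 + ‖x.space‖ ^ 2) * (1 + ‖y.space‖ ^ 2) := by
      rw [mul_pow]
      congr 1 <;> linarith
    rw [e]
    nlinarith [sq_nonneg (‖x.space‖ - ‖y.space‖)]
  linarith

/-- The Minkowski form is negative definite on the orthogonal complement of a point. -/
theorem sq_mul_le_of_orthogonal (y : Hyperboloid E) (a : ℝ) (w : E)
    (h : a * y.time = inner ℝ w y.space) : a ^ 2 + a ^ 2 * ‖y.space‖ ^ 2 ≤
      ‖w‖ ^ 2 * ‖y.space‖ ^ 2 := by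
  have h1 : (inner ℝ w y.space) ^ 2 ≤ (‖w‖ * ‖y.space‖) ^ 2 :=
    sq_le_sq' (by linarith [neg_le_of_abs_le (abs_real_inner_le_norm w y.space)])
      (real_inner_le_norm _ _)
  rw [← h] at h1
  have hy : y.time ^ 2 = 1 + ‖y.space‖ ^ 2 := by linarith [y.form_eq_one]
  rw [mul_pow, hy, mul_pow] at h1
  linarith

theorem sq_le_of_orthogonal (y : Hyperboloid E) (a : ℝ) (w : E)
    (h : a * y.time = inner ℝ w y.space) : a ^ 2 ≤ ‖w‖ ^ 2 := by
  have h1 := sq_mul_le_of_orthogonal y a w h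
  have h2 := y.form_eq_one
  by_contra hc
  push Not at hc
  nlinarith [sq_nonneg a, sq_nonneg ‖y.space‖,
    mul_nonneg (sub_nonneg.2 hc.le) (sq_nonneg ‖y.space‖), sq_nonneg ‖w‖]

theorem eq_of_form_eq_one (x y : Hyperboloid E) (h : form x y = 1) : x = y := by
  have hn := norm_sub_sq_real x.space y.space
  have hx := x.form_eq_one
  have hy := y.form_eq_one
  unfold form at h
  have h1 := sq_mul_le_of_orthogonal y (x.time - y.time) (x.space - y.space) (by
    rw [inner_sub_left, real_inner_self_eq_norm_sq]
    linear_combination h - hy)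
  have h2 : ‖x.space - y.space‖ ^ 2 = (x.time - y.time) ^ 2 := by
    rw [hn]
    linear_combination 2 * h - hx - hy
  rw [h2] at h1
  have h3 : (x.time - y.time) ^ 2 = 0 := le_antisymm (by linarith) (sq_nonneg _)
  rw [h3] at h2
  ext
  · exact sub_eq_zero.1 (pow_eq_zero_iff two_ne_zero |>.1 h3)
  · exact sub_eq_zero.1 (norm_eq_zero.1 (pow_eq_zero_iff two_ne_zero |>.1 h2))

theorem sq_form_sub_le (x y z : Hyperboloid E) :
    (form x z - form x y * form y z) ^ 2 ≤ (form x y ^ 2 - 1) * (form y z ^ 2 - 1) := by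
  have hx := x.form_eq_one
  have hy := y.form_eq_one
  have hz := z.form_eq_one
  set P := form x y with hP
  set Q := form y z with hQ
  set N := form x z with hN
  simp only [form] at hP hQ hN
  have key : ∀ r : ℝ, 0 ≤ (Q ^ 2 - 1) * (r * r) + (2 * (P * Q - N)) * r + (P ^ 2 - 1) := by
    intro r
    have h := sq_le_of_orthogonal y
      (x.time - P * y.time + r * (z.time - Q * y.time))
      (x.space - P • y.space + r • (z.space - Q • y.space)) (by
        simp only [inner_add_left, inner_sub_left, real_inner_smul_left,
          real_inner_self_eq_norm_sq]
        rw [real_inner_comm z.space y.space] at *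
        linear_combination (-P - r * Q) * hy - hP - r * hQ)
    rw [← real_inner_self_eq_norm_sq] at h
    simp only [inner_add_left, inner_sub_left, inner_add_right, inner_sub_right,
      real_inner_smul_left, real_inner_smul_right] at h
    simp only [real_inner_self_eq_norm_sq] at h
    rw [real_inner_comm x.space y.space, real_inner_comm y.space z.space,
      real_inner_comm x.space z.space] at h
    have e1 : inner ℝ x.space y.space = x.time * y.time - P := by linarith
    have e2 : inner ℝ y.space z.space = y.time * z.time - Q := by linarith
    have e3 : inner ℝ x.space z.space = x.time * z.time - N := by linarith
    have e4 : ‖x.space‖ ^ 2 = x.time ^ 2 - 1 := by linarith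
    have e5 : ‖y.space‖ ^ 2 = y.time ^ 2 - 1 := by linarith
    have e6 : ‖z.space‖ ^ 2 = z.time ^ 2 - 1 := by linarith
    rw [e1, e2, e3, e4, e5, e6] at h
    linarith
  have hd := discrim_le_zero key
  unfold discrim at hd
  nlinarith

instance instMetricSpace : MetricSpace (Hyperboloid E) where
  dist x y := Real.arcosh (form x y)
  dist_self x := by
    rw [form_self]
    exact (Real.arcosh_eq_zero_iff le_rfl).2 rfl
  dist_comm x y := by
    rw [form_comm]
  dist_triangle x y z := by
    have hP := one_le_form x y
    have hQ := one_le_form y z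
    have hN := one_le_form x z
    have h0 : 0 ≤ Real.arcosh (form x y) + Real.arcosh (form y z) :=
      add_nonneg (Real.arcosh_nonneg hP) (Real.arcosh_nonneg hQ)
    rw [← Real.arcosh_cosh h0, Real.arcosh_le_arcosh (by linarith) (Real.cosh_pos _),
      Real.cosh_add, Real.cosh_arcosh hP, Real.cosh_arcosh hQ, Real.sinh_arcosh hP,
      Real.sinh_arcosh hQ, ← Real.sqrt_mul (by nlinarith)]
    have := Real.le_sqrt_of_sq_le (sq_form_sub_le x y z)
    linarith
  eq_of_dist_eq_zero := by
    intro x y h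
    exact eq_of_form_eq_one x y ((Real.arcosh_eq_zero_iff (one_le_form x y)).1 h)

end Hyperboloid

/-- The real algebraic hyperbolic space `H^κ`, for a cardinal `κ`: the hyperboloid model over the
Hilbert space `ℓ²(κ)` of dimension `κ`, with the distance given by `cosh d(x, y) = ⟨x, y⟩`. -/
abbrev AlgHyperbolicSpace (κ : Cardinal.{u}) : Type u :=
  Hyperboloid (lp (fun _ : κ.out => ℝ) 2)

end Hyperboloid

/-! ## Abstract and algebraic cross-ratios -/

section CrossRatio

variable {Y : Type*}

/-- At least three of the four points are distinct. -/
def AtLeastThreeDistinct (a b c d : Y) : Prop :=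
  (a ≠ b ∧ a ≠ c ∧ b ≠ c) ∨ (a ≠ b ∧ a ≠ d ∧ b ≠ d) ∨
    (a ≠ c ∧ a ≠ d ∧ c ≠ d) ∨ (b ≠ c ∧ b ≠ d ∧ c ≠ d)

variable (Y) in
/-- The set `Y⁽⁴⁾ ⊆ Y⁴` of quadruples of which at least three are distinct. -/
def quadruples : Set (Y × Y × Y × Y) :=
  {q | AtLeastThreeDistinct q.1 q.2.1 q.2.2.1 q.2.2.2}

/-- A kernel of conditionally negative type. -/
structure IsCondNegType {Z : Type*} (K : Z → Z → ℝ) : Prop where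
  symm : ∀ x y, K x y = K y x
  diag : ∀ x, K x x = 0
  nonpos : ∀ (n : ℕ) (x : Fin n → Z) (l : Fin n → ℝ), ∑ i, l i = 0 →
    ∑ i, ∑ j, l i * l j * K (x i) (x j) ≤ 0

/-- Abstract cross-ratios. Only the values of `B` on `Y⁽⁴⁾` matter. The cocycle relation is required
whenever its right-hand side is not an indeterminate product `0 * ∞`. -/
structure IsAbstractCrossRatio [TopologicalSpace Y] (B : Y → Y → Y → Y → ℝ≥0∞) : Prop where
  continuousOn :
    ContinuousOn (fun q : Y × Y × Y × Y => B q.1 q.2.1 q.2.2.1 q.2.2.2) (quadruples Y)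
  exchange : ∀ x x' y y', AtLeastThreeDistinct x x' y y' → B x x' y y' = B y y' x x'
  reverse : ∀ x x' y y', AtLeastThreeDistinct x x' y y' → B x x' y y' = B x' x y' y
  inversion_left : ∀ x x' y y', AtLeastThreeDistinct x x' y y' → B x x' y y' = (B y x' x y')⁻¹
  inversion_right : ∀ x x' y y', AtLeastThreeDistinct x x' y y' → B x x' y y' = (B x y' y x')⁻¹
  cocycle : ∀ x y x' y' x'', AtLeastThreeDistinct x y x' y' → AtLeastThreeDistinct x y x'' y' →
    AtLeastThreeDistinct x'' y x' y' →
    (B x y x'' y' ≠ 0 ∨ B x'' y x' y' ≠ ∞) → (B x y x'' y' ≠ ∞ ∨ B x'' y x' y' ≠ 0) →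
    B x y x' y' = B x y x'' y' * B x'' y x' y'
  eq_zero_iff : ∀ x x' y y', AtLeastThreeDistinct x x' y y' →
    (B x x' y y' = 0 ↔ x = x' ∨ y = y')
  eq_top_iff : ∀ x x' y y', AtLeastThreeDistinct x x' y y' →
    (B x x' y y' = ∞ ↔ x = y' ∨ y = x')

open Classical in
/-- The kernel `(x, y) ↦ (R(x, y, p, w) R(y, p, q, w))²` on `Y \ {w}` attached to a triple
`(p, q, w)` of distinct points, playing the role of `(0, 1, ∞)`; it is `0` on the diagonal, and where
`y = p ≠ x` the indeterminate product `R(x, p, p, w) R(p, p, q, w) = ∞ * 0` is read as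
`R(x, p, q, w)`. All values of `R` involved are finite. -/
def crossRatioKernel (R : Y → Y → Y → Y → ℝ≥0∞) (p q w : Y) (x y : {y : Y // y ≠ w}) : ℝ :=
  if x = y then 0
  else if (y : Y) = p then (R x p q w).toReal ^ 2
  else (R x y p w * R y p q w).toReal ^ 2

/-- Algebraic cross-ratios. -/
structure IsAlgebraicCrossRatio [TopologicalSpace Y] (R : Y → Y → Y → Y → ℝ≥0∞) : Prop
    extends IsAbstractCrossRatio R where
  condNegType : ∀ p q w : Y, p ≠ q → p ≠ w → q ≠ w → IsCondNegType (crossRatioKernel R p q w)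

/-- `f : Y → ∂H^κ` is continuous with total image, and the boundary cross-ratio of `H^κ` pulls back
to `R` under `f`. -/
structure RealizesCrossRatio [TopologicalSpace Y] (R : Y → Y → Y → Y → ℝ≥0∞)
    (κ : Cardinal.{u}) (f : Y → GromovBoundary (AlgHyperbolicSpace κ)) : Prop where
  continuous : Continuous f
  total : IsTotalBoundarySet (Set.range f)
  crossRatio_eq : ∀ (o : AlgHyperbolicSpace κ) (a b c d : Y), AtLeastThreeDistinct a b c d →
    boundaryCrossRatio o (f a) (f b) (f c) (f d) = R a b c d

end CrossRatio

end

/-!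
A light vector of the Minkowski space `ℝ × E` is determined up to scaling by a boundary point of the
hyperboloid. Normalized as `(1, ξ)`, two of them pair to half the squared chordal distance of the
directions, and the visual metric at a base point is a conformal multiple of the chordal distance.
Hence the boundary cross-ratio is the cross-ratio of chordal distances, which is insensitive to
rescaling each light vector.

Existence: by the GNS construction the conditionally negative kernel attached to a triple is a
squared distance in a Hilbert space. Horospherical coordinates lift the points of that Hilbert space
to light vectors whose pairings are twice the values of the kernel, and the cocycle identities
recover `R` from these. The minimal Hilbert space makes the image total, because closed totally
geodesic subspaces correspond to closed linear subspaces of `ℝ × E`, so that totality means that the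
light vectors span a dense subspace.

Uniqueness: for two realizations, the quotient of the chordal distances satisfies the four-cycle
identity `ρ a b * ρ c d = ρ a d * ρ c b` and is therefore a product `μ x * μ y`. After rescaling,
the two families of light vectors have the same Gram matrix and so differ by a linear isometry of
the Minkowski spaces. A distance-preserving map with prescribed boundary values is determined on
light vectors up to dilation factors, and three boundary points force these factors to agree.
Equivariance follows from uniqueness.
-/

noncomputable section

/-! ### Minkowski space -/

/-- The vector `(1, ξ)`, which represents in homogeneous coordinates the point `ξ` of the
projective model of the hyperbolic space. It is isotropic when `ξ` is a unit vector. -/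
def homogenize {V : Type*} (ξ : V) : ℝ × V := (1, ξ)

theorem tendsto_homogenize {V α : Type*} [TopologicalSpace V] {l : Filter α} {f : α → V} {ξ : V}
    (hf : Tendsto f l (𝓝 ξ)) : Tendsto (fun n => homogenize (f n)) l (𝓝 (homogenize ξ)) :=
  tendsto_const_nhds.prodMk_nhds hf

namespace Hyperboloid

variable {V : Type*} [NormedAddCommGroup V]

/-- The point of the hyperboloid as a vector of the Minkowski space. -/
def vec (x : Hyperboloid V) : ℝ × V := (x.time, x.space)

theorem vec_injective : Function.Injective (vec : Hyperboloid V → ℝ × V) :=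
  fun _ _ h => Hyperboloid.ext (congrArg Prod.fst h) (congrArg Prod.snd h)

end Hyperboloid

/-- The Minkowski form `v₀ w₀ - ⟪v', w'⟫` of `ℝ × E`, written `⟪v, w⟫ₘ`, as a continuous bilinear
map. It extends `Hyperboloid.form` to all vectors. -/
def minkowskiForm {E : Type*} [NormedAddCommGroup E] [InnerProductSpace ℝ E] :
    (ℝ × E) →L[ℝ] (ℝ × E) →L[ℝ] ℝ :=
  (ContinuousLinearMap.mul ℝ ℝ).bilinearComp
      (ContinuousLinearMap.fst ℝ ℝ E) (ContinuousLinearMap.fst ℝ ℝ E) -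
    (isBoundedBilinearMap_inner (𝕜 := ℝ)).toContinuousLinearMap.bilinearComp
      (ContinuousLinearMap.snd ℝ ℝ E) (ContinuousLinearMap.snd ℝ ℝ E)

local notation "⟪" v "," w "⟫ₘ" => minkowskiForm v w

theorem exp_neg_two_mul_gromovProduct {X : Type*} [MetricSpace X] (o x y : X) :
    Real.exp (-(2 * gromovProduct o x y)) =
      Real.exp (dist x y) / (Real.exp (dist o x) * Real.exp (dist o y)) := by
  rw [← Real.exp_add, ← Real.exp_sub]
  congr 1
  unfold gromovProduct
  ring

section Minkowski

variable {E : Type*} [NormedAddCommGroup E] [InnerProductSpace ℝ E]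

theorem minkowskiForm_apply (v w : ℝ × E) : ⟪v, w⟫ₘ = v.1 * w.1 - inner ℝ v.2 w.2 := rfl

attribute [irreducible] minkowskiForm

theorem minkowskiForm_comm (v w : ℝ × E) : ⟪v, w⟫ₘ = ⟪w, v⟫ₘ := by
  rw [minkowskiForm_apply, minkowskiForm_apply, mul_comm, real_inner_comm]

theorem minkowskiForm_self (v : ℝ × E) : ⟪v, v⟫ₘ = v.1 ^ 2 - ‖v.2‖ ^ 2 := by
  rw [minkowskiForm_apply, real_inner_self_eq_norm_sq, sq v.1]

theorem continuous_minkowskiForm : Continuous fun p : (ℝ × E) × (ℝ × E) => ⟪p.1, p.2⟫ₘ := by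
  simp only [minkowskiForm_apply]
  fun_prop

theorem tendsto_minkowskiForm {α : Type*} {l : Filter α} {f g : α → ℝ × E} {v w : ℝ × E}
    (hf : Tendsto f l (𝓝 v)) (hg : Tendsto g l (𝓝 w)) :
    Tendsto (fun n => ⟪f n, g n⟫ₘ) l (𝓝 ⟪v, w⟫ₘ) :=
  (continuous_minkowskiForm.tendsto (v, w)).comp (hf.prodMk_nhds hg)

theorem eq_zero_of_minkowskiForm_eq_zero {v : ℝ × E} (h : minkowskiForm v = 0) : v = 0 := by
  have htime : ⟪v, (1, 0)⟫ₘ = 0 := by rw [h, zero_apply]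
  have hspace : ⟪v, (0, v.2)⟫ₘ = 0 := by rw [h, zero_apply]
  simp only [minkowskiForm_apply, inner_zero_right, mul_one, sub_zero] at htime
  simp only [minkowskiForm_apply, mul_zero, zero_sub, neg_eq_zero, inner_self_eq_zero] at hspace
  exact Prod.ext htime hspace

theorem eq_of_minkowskiForm_eqOn {v w : ℝ × E} {s : Set (ℝ × E)}
    (hs : Dense (Submodule.span ℝ s : Set (ℝ × E)))
    (h : Set.EqOn (minkowskiForm v) (minkowskiForm w) s) : v = w :=
  sub_eq_zero.1 <| eq_zero_of_minkowskiForm_eq_zero <| by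
    rw [map_sub, sub_eq_zero, ContinuousLinearMap.ext_on hs h]

theorem minkowskiForm_homogenize {ξ η : E} (hξ : ‖ξ‖ = 1) (hη : ‖η‖ = 1) :
    ⟪homogenize ξ, homogenize η⟫ₘ = dist ξ η ^ 2 / 2 := by
  rw [minkowskiForm_apply, dist_eq_norm, norm_sub_sq_real, hξ, hη]
  simp only [homogenize]
  ring

variable (E) in
/-- The open future cone of the Minkowski space, that is, the cone over the hyperboloid. -/
def futureCone : Set (ℝ × E) := {v | 0 < v.1 ∧ 0 < ⟪v, v⟫ₘ}

theorem isOpen_futureCone : IsOpen (futureCone E) :=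
  (isOpen_lt continuous_const continuous_fst).inter
    (isOpen_lt continuous_const
      (continuous_minkowskiForm.comp (continuous_id.prodMk continuous_id)))

theorem norm_snd_lt_of_mem_futureCone {v : ℝ × E} (hv : v ∈ futureCone E) : ‖v.2‖ < v.1 := by
  have hpos := hv.2
  rw [minkowskiForm_self, sub_pos] at hpos
  exact lt_of_pow_lt_pow_left₀ 2 hv.1.le hpos

theorem minkowskiForm_pos_of_mem_futureCone {v w : ℝ × E} (hv : v ∈ futureCone E)
    (hw : 0 < w.1) (hww : 0 ≤ ⟪w, w⟫ₘ) : 0 < ⟪v, w⟫ₘ := by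
  rw [minkowskiForm_self, sub_nonneg] at hww
  have hle : ‖w.2‖ ≤ w.1 := abs_norm w.2 ▸ abs_le_of_sq_le_sq hww hw.le
  have hlt : ‖v.2‖ * ‖w.2‖ < v.1 * w.1 :=
    (mul_le_mul_of_nonneg_left hle (norm_nonneg _)).trans_lt
      (mul_lt_mul_of_pos_right (norm_snd_lt_of_mem_futureCone hv) hw)
  rw [minkowskiForm_apply]
  linarith [real_inner_le_norm v.2 w.2]

theorem fst_pos_of_minkowskiForm_pos {v w : ℝ × E} (hv : v ∈ futureCone E) (hww : 0 ≤ ⟪w, w⟫ₘ)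
    (hvw : 0 < ⟪v, w⟫ₘ) : 0 < w.1 := by
  rw [minkowskiForm_self, sub_nonneg] at hww
  rw [minkowskiForm_apply] at hvw
  by_contra! hle
  have hnorm : ‖w.2‖ ≤ -w.1 := abs_of_nonpos hle ▸ (abs_norm w.2).ge.trans (sq_le_sq.1 hww)
  have hcs := neg_le_of_abs_le (abs_real_inner_le_norm v.2 w.2)
  nlinarith [norm_snd_lt_of_mem_futureCone hv, norm_nonneg v.2]

theorem minkowskiForm_homogenize_pos {v : ℝ × E} (hv : v ∈ futureCone E) {ξ : E} (hξ : ‖ξ‖ = 1) :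
    0 < ⟪v, homogenize ξ⟫ₘ :=
  minkowskiForm_pos_of_mem_futureCone hv one_pos <| by
    rw [minkowskiForm_homogenize hξ hξ]
    positivity

theorem add_mem_futureCone {v w : ℝ × E} (hv : v ∈ futureCone E) (hw : w ∈ futureCone E) :
    v + w ∈ futureCone E := by
  have hvw := minkowskiForm_pos_of_mem_futureCone hv hw.1 hw.2.le
  refine ⟨add_pos hv.1 hw.1, ?_⟩
  simp only [map_add, add_apply, minkowskiForm_comm w v]
  linarith [hv.2, hw.2]

theorem smul_mem_futureCone {t : ℝ} (ht : 0 < t) {v : ℝ × E} (hv : v ∈ futureCone E) :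
    t • v ∈ futureCone E :=
  ⟨mul_pos ht hv.1, by
    simpa only [map_smul, smul_apply, smul_eq_mul] using mul_pos ht (mul_pos ht hv.2)⟩

namespace Hyperboloid

theorem form_eq_minkowskiForm (x y : Hyperboloid E) : form x y = ⟪x.vec, y.vec⟫ₘ :=
  (minkowskiForm_apply x.vec y.vec).symm

theorem minkowskiForm_vec_self (x : Hyperboloid E) : ⟪x.vec, x.vec⟫ₘ = 1 := by
  rw [← form_eq_minkowskiForm, form_self]

theorem vec_mem_futureCone (x : Hyperboloid E) : x.vec ∈ futureCone E :=
  ⟨x.time_pos, by rw [minkowskiForm_vec_self]; exact one_pos⟩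

/-- The point of the hyperboloid with a given vector. -/
def ofVec (v : ℝ × E) (hpos : 0 < v.1) (hone : ⟪v, v⟫ₘ = 1) : Hyperboloid E where
  time := v.1
  space := v.2
  time_pos := hpos
  form_eq_one := by rw [← minkowskiForm_self, hone]

theorem minkowskiForm_normalize {v : ℝ × E} (hv : 0 < ⟪v, v⟫ₘ) :
    ⟪(√⟪v, v⟫ₘ)⁻¹ • v, (√⟪v, v⟫ₘ)⁻¹ • v⟫ₘ = 1 := by
  simp only [map_smul, smul_apply, smul_eq_mul]
  rw [← mul_assoc, ← mul_inv, Real.mul_self_sqrt hv.le, inv_mul_cancel₀ hv.ne']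

/-- The point of the hyperboloid on the ray of a vector of the future cone. -/
def normalize (v : ℝ × E) (hv : v ∈ futureCone E) : Hyperboloid E :=
  ofVec ((√⟪v, v⟫ₘ)⁻¹ • v) (mul_pos (inv_pos.2 (Real.sqrt_pos.2 hv.2)) hv.1)
    (minkowskiForm_normalize hv.2)

theorem vec_normalize (v : ℝ × E) (hv : v ∈ futureCone E) :
    (normalize v hv).vec = (√⟪v, v⟫ₘ)⁻¹ • v := rfl

theorem smul_vec_normalize (v : ℝ × E) (hv : v ∈ futureCone E) :
    √⟪v, v⟫ₘ • (normalize v hv).vec = v := by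
  rw [vec_normalize, smul_inv_smul₀ (Real.sqrt_pos.2 hv.2).ne']

/-- The origin `(1, 0)` of the hyperboloid. -/
def origin : Hyperboloid E := ⟨1, 0, one_pos, by simp⟩

theorem form_origin (x : Hyperboloid E) : form origin x = x.time := by
  simp [form, origin]

theorem minkowskiForm_origin_homogenize (ξ : E) :
    ⟪(origin : Hyperboloid E).vec, homogenize ξ⟫ₘ = 1 := by
  simp [minkowskiForm_apply, origin, vec, homogenize]

theorem cosh_dist (x y : Hyperboloid E) : Real.cosh (dist x y) = form x y :=
  Real.cosh_arcosh (one_le_form x y)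

theorem exp_dist_eq (x y : Hyperboloid E) :
    Real.exp (dist x y) = 2 * form x y - Real.exp (-dist x y) := by
  rw [← cosh_dist, Real.cosh_eq]
  ring

theorem exp_dist_le (x y : Hyperboloid E) : Real.exp (dist x y) ≤ 2 * form x y := by
  rw [exp_dist_eq]
  linarith [Real.exp_pos (-dist x y)]

theorem form_le_exp_dist (x y : Hyperboloid E) : form x y ≤ Real.exp (dist x y) := by
  have hexp : Real.exp (-dist x y) ≤ Real.exp (dist x y) :=
    Real.exp_le_exp.2 (neg_le_self dist_nonneg)
  linarith [exp_dist_eq x y]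

theorem isometry_iff_form_eq {F : Type*} [NormedAddCommGroup F] [InnerProductSpace ℝ F]
    {φ : Hyperboloid E → Hyperboloid F} :
    Isometry φ ↔ ∀ x y, form (φ x) (φ y) = form x y := by
  refine ⟨fun h x y => ?_, fun h => Isometry.of_dist_eq fun x y => ?_⟩
  · rw [← cosh_dist, ← cosh_dist, h.dist_eq]
  · exact Real.cosh_injOn dist_nonneg dist_nonneg (by rw [cosh_dist, cosh_dist, h])

/-- The projection of the hyperboloid to the open unit ball, that is, the projective model. -/
def klein (x : Hyperboloid E) : E := x.time⁻¹ • x.space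

theorem homogenize_klein (x : Hyperboloid E) : homogenize (klein x) = x.time⁻¹ • x.vec :=
  Prod.ext (inv_mul_cancel₀ x.time_pos.ne').symm rfl

theorem klein_normalize (v : ℝ × E) (hv : v ∈ futureCone E) :
    klein (normalize v hv) = v.1⁻¹ • v.2 := by
  have hnorm : √⟪v, v⟫ₘ ≠ 0 := (Real.sqrt_pos.2 hv.2).ne'
  change ((√⟪v, v⟫ₘ)⁻¹ * v.1)⁻¹ • (√⟪v, v⟫ₘ)⁻¹ • v.2 = _
  rw [smul_smul, mul_inv, inv_inv, mul_right_comm, mul_inv_cancel₀ hnorm, one_mul]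

theorem norm_klein_sq (x : Hyperboloid E) : ‖klein x‖ ^ 2 = 1 - (x.time ^ 2)⁻¹ := by
  have hform := x.form_eq_one
  have htime := x.time_pos.ne'
  rw [klein, norm_smul, mul_pow, norm_inv, inv_pow, Real.norm_eq_abs, sq_abs]
  field_simp
  linarith

theorem norm_klein_sq_le_one (x : Hyperboloid E) : ‖klein x‖ ^ 2 ≤ 1 := by
  rw [norm_klein_sq]
  exact sub_le_self _ (by positivity)

theorem one_sub_inner_klein (x y : Hyperboloid E) :
    1 - inner ℝ (klein x) (klein y) = form x y / (x.time * y.time) := by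
  have hx := x.time_pos.ne'
  have hy := y.time_pos.ne'
  simp only [klein, form, real_inner_smul_left, real_inner_smul_right]
  field_simp

theorem one_sub_inner_klein_le (x y : Hyperboloid E) :
    1 - inner ℝ (klein x) (klein y) ≤ 4 * Real.exp (-(2 * gromovProduct origin x y)) := by
  have hx := x.time_pos
  have hy := y.time_pos
  have htime (z : Hyperboloid E) : Real.exp (dist origin z) ≤ 2 * z.time :=
    form_origin z ▸ exp_dist_le origin z
  calc 1 - inner ℝ (klein x) (klein y) = form x y / (x.time * y.time) := one_sub_inner_klein x y
    _ ≤ Real.exp (dist x y) / (x.time * y.time) := by gcongr; exact form_le_exp_dist x y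
    _ = 4 * (Real.exp (dist x y) / (2 * x.time * (2 * y.time))) := by field_simp; norm_num
    _ ≤ 4 * Real.exp (-(2 * gromovProduct origin x y)) := by
        rw [exp_neg_two_mul_gromovProduct]
        gcongr <;> exact htime _

theorem dist_klein_sq_le (x y : Hyperboloid E) :
    dist (klein x) (klein y) ^ 2 ≤ 8 * Real.exp (-(2 * gromovProduct origin x y)) := by
  rw [dist_eq_norm, norm_sub_sq_real]
  linarith [norm_klein_sq_le_one x, norm_klein_sq_le_one y, one_sub_inner_klein_le x y]

end Hyperboloid

end Minkowski

/-! ### The Gromov boundary of the hyperboloid is the unit sphere -/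

theorem tendsto_fst_atTop_prod {α β : Type*} [Preorder α] [Preorder β] :
    Tendsto (Prod.fst : α × β → α) atTop atTop := by
  rw [← prod_atTop_atTop_eq]
  exact tendsto_fst

theorem tendsto_snd_atTop_prod {α β : Type*} [Preorder α] [Preorder β] :
    Tendsto (Prod.snd : α × β → β) atTop atTop := by
  rw [← prod_atTop_atTop_eq]
  exact tendsto_snd

section Metric

variable {X : Type*} [MetricSpace X]

theorem gromovProduct_nonneg (o x y : X) : 0 ≤ gromovProduct o x y := by
  unfold gromovProduct
  linarith [dist_triangle_left x y o]

theorem GromovBoundary.exists_limit_eq (ξ : GromovBoundary X) :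
    ∃ s : InfinitySeq X, s.limit = ξ :=
  Quot.exists_rep ξ

theorem boundaryGromovProduct_eq_of_tendsto {o : X} {ξ η : GromovBoundary X} {L : ℝ≥0∞}
    (h : ∀ s t : InfinitySeq X, s.limit = ξ → t.limit = η →
      Tendsto (fun p : ℕ × ℕ => ENNReal.ofReal (gromovProduct o (s.1 p.1) (t.1 p.2))) atTop
        (𝓝 L)) : boundaryGromovProduct o ξ η = L := by
  obtain ⟨s, hs⟩ := ξ.exists_limit_eq
  obtain ⟨t, ht⟩ := η.exists_limit_eq
  refine le_antisymm ?_ ?_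
  · exact (iInf_le_of_le s <| iInf_le_of_le t <| iInf_le_of_le hs <| iInf_le _ ht).trans
      (h s t hs ht).liminf_eq.le
  · exact le_iInf fun s' => le_iInf fun t' => le_iInf fun hs' => le_iInf fun ht' =>
      (h s' t' hs' ht').liminf_eq.ge

theorem visualDist_eq_of_tendsto {o : X} {ξ η : GromovBoundary X} {D : ℝ}
    (h : ∀ s t : InfinitySeq X, s.limit = ξ → t.limit = η →
      Tendsto (fun p : ℕ × ℕ => Real.exp (-gromovProduct o (s.1 p.1) (t.1 p.2))) atTop (𝓝 D)) :
    visualDist o ξ η = ENNReal.ofReal D := by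
  have hD : D ≤ 1 := by
    obtain ⟨s, hs⟩ := ξ.exists_limit_eq
    obtain ⟨t, ht⟩ := η.exists_limit_eq
    exact le_of_tendsto' (h s t hs ht) fun p =>
      Real.exp_le_one_iff.2 (neg_nonpos.2 (gromovProduct_nonneg _ _ _))
  have hlog : 0 ≤ -(ENNReal.ofReal D).log := by
    rw [EReal.neg_nonneg, ENNReal.log_le_zero_iff]
    exact ENNReal.ofReal_le_one.2 hD
  have hexp (g : ℝ) :
      (-(ENNReal.ofReal (Real.exp (-g))).log).toENNReal = ENNReal.ofReal g := by
    rw [ENNReal.log_ofReal_of_pos (Real.exp_pos _), Real.log_exp, ← EReal.coe_neg, neg_neg,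
      EReal.toENNReal_of_ne_top (EReal.coe_ne_top g), EReal.toReal_coe]
  have hprod : boundaryGromovProduct o ξ η = (-(ENNReal.ofReal D).log).toENNReal := by
    refine boundaryGromovProduct_eq_of_tendsto fun s t hs ht => ?_
    simp only [← hexp (gromovProduct _ _ _)]
    have hcont : Continuous fun x : ℝ => (-(ENNReal.ofReal x).log).toENNReal :=
      EReal.continuous_toENNReal.comp <|
        continuous_neg.comp (ENNReal.continuous_log.comp ENNReal.continuous_ofReal)
    exact (hcont.tendsto D).comp (h s t hs ht)
  rw [visualDist, hprod, EReal.coe_toENNReal hlog, neg_neg, ENNReal.exp_log]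

end Metric

namespace Hyperboloid

variable {E : Type*} [NormedAddCommGroup E] [InnerProductSpace ℝ E] {α : Type*} {l : Filter α}

theorem tendsto_mul_exp_dist {a b : α → ℝ} {x y : α → Hyperboloid E} {v w : ℝ × E}
    (hx : Tendsto (fun n => a n • (x n).vec) l (𝓝 v))
    (hy : Tendsto (fun n => b n • (y n).vec) l (𝓝 w))
    (hab : Tendsto (fun n => a n * b n) l (𝓝 0)) :
    Tendsto (fun n => a n * b n * Real.exp (dist (x n) (y n))) l (𝓝 (2 * ⟪v, w⟫ₘ)) := by
  have hbdd : IsBoundedUnder (· ≤ ·) l fun n => ‖Real.exp (-dist (x n) (y n))‖ :=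
    isBoundedUnder_of ⟨1, fun n => by
      rw [Real.norm_eq_abs, Real.abs_exp, Real.exp_le_one_iff, neg_nonpos]
      exact dist_nonneg⟩
  have hlim := ((tendsto_minkowskiForm hx hy).const_mul 2).sub
    (hab.zero_mul_isBoundedUnder_le hbdd)
  rw [sub_zero] at hlim
  refine hlim.congr fun n => ?_
  rw [exp_dist_eq, form_eq_minkowskiForm]
  simp only [map_smul, smul_apply, smul_eq_mul]
  ring

theorem inv_time_eq_sqrt (x : Hyperboloid E) : x.time⁻¹ = √(1 - ‖klein x‖ ^ 2) := by
  rw [norm_klein_sq, sub_sub_cancel, ← inv_pow, Real.sqrt_sq (inv_pos.2 x.time_pos).le]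

theorem tendsto_inv_time {s : α → Hyperboloid E} {ξ : E} (hξ : ‖ξ‖ = 1)
    (hs : Tendsto (fun n => klein (s n)) l (𝓝 ξ)) :
    Tendsto (fun n => (s n).time⁻¹) l (𝓝 0) := by
  simpa [inv_time_eq_sqrt, hξ] using ((hs.norm.pow 2).const_sub 1).sqrt

theorem tendsto_inv_time_smul_vec {s : α → Hyperboloid E} {ξ : E}
    (hs : Tendsto (fun n => klein (s n)) l (𝓝 ξ)) :
    Tendsto (fun n => (s n).time⁻¹ • (s n).vec) l (𝓝 (homogenize ξ)) := by
  simpa only [homogenize_klein] using tendsto_homogenize hs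

theorem tendsto_klein_of_tendsto_smul_vec {s : α → Hyperboloid E} {c : α → ℝ} {v : ℝ × E}
    (hv : v.1 ≠ 0) (hs : Tendsto (fun n => c n • (s n).vec) l (𝓝 v)) :
    Tendsto (fun n => klein (s n)) l (𝓝 (v.1⁻¹ • v.2)) := by
  have htime : Tendsto (fun n => c n * (s n).time) l (𝓝 v.1) := (continuous_fst.tendsto v).comp hs
  have hspace : Tendsto (fun n => c n • (s n).space) l (𝓝 v.2) :=
    (continuous_snd.tendsto v).comp hs
  refine ((htime.inv₀ hv).smul hspace).congr' ?_
  filter_upwards [htime.eventually_ne hv] with n hn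
  rw [smul_smul, klein, mul_inv, mul_right_comm, inv_mul_cancel₀ (left_ne_zero_of_mul hn), one_mul]

/-- The factor by which the visual distance from `o` differs at the unit vector `ξ` from the
distance of the unit sphere. -/
def visualScale (o : Hyperboloid E) (ξ : E) : ℝ := (√(2 * ⟪o.vec, homogenize ξ⟫ₘ))⁻¹

theorem visualScale_pos (o : Hyperboloid E) {ξ : E} (hξ : ‖ξ‖ = 1) : 0 < visualScale o ξ :=
  inv_pos.2 <| Real.sqrt_pos.2 <|
    mul_pos two_pos (minkowskiForm_homogenize_pos o.vec_mem_futureCone hξ)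

theorem visualScale_sq (o : Hyperboloid E) {ξ : E} (hξ : ‖ξ‖ = 1) :
    visualScale o ξ ^ 2 = (2 * ⟪o.vec, homogenize ξ⟫ₘ)⁻¹ := by
  have hpos := minkowskiForm_homogenize_pos o.vec_mem_futureCone hξ
  rw [visualScale, inv_pow, Real.sq_sqrt (by positivity)]

theorem tendsto_exp_neg_gromovProduct (o : Hyperboloid E) {s t : α → Hyperboloid E} {ξ η : E}
    (hξ : ‖ξ‖ = 1) (hη : ‖η‖ = 1) (hs : Tendsto (fun n => klein (s n)) l (𝓝 ξ))
    (ht : Tendsto (fun n => klein (t n)) l (𝓝 η)) :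
    Tendsto (fun n => Real.exp (-gromovProduct o (s n) (t n))) l
      (𝓝 (dist ξ η * visualScale o ξ * visualScale o η)) := by
  have hbase {r : α → Hyperboloid E} {ζ : E} (hζ : ‖ζ‖ = 1)
      (hr : Tendsto (fun n => klein (r n)) l (𝓝 ζ)) :
      Tendsto (fun n => (1 * (r n).time⁻¹ * Real.exp (dist o (r n)))⁻¹) l
        (𝓝 (visualScale o ζ ^ 2)) := by
    rw [visualScale_sq o hζ]
    refine (tendsto_mul_exp_dist (v := o.vec) ?_ (tendsto_inv_time_smul_vec hr) ?_).inv₀ ?_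
    · simpa only [one_smul] using tendsto_const_nhds
    · simpa only [one_mul] using tendsto_inv_time hζ hr
    · exact (mul_pos two_pos (minkowskiForm_homogenize_pos o.vec_mem_futureCone hζ)).ne'
  have hdist : Tendsto (fun n => (s n).time⁻¹ * (t n).time⁻¹ * Real.exp (dist (s n) (t n))) l
      (𝓝 (2 * ⟪homogenize ξ, homogenize η⟫ₘ)) :=
    tendsto_mul_exp_dist (tendsto_inv_time_smul_vec hs) (tendsto_inv_time_smul_vec ht)
      (by simpa only [mul_zero] using (tendsto_inv_time hξ hs).mul (tendsto_inv_time hη ht))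
  have hsq := ((hdist.mul (hbase hξ hs)).mul (hbase hη ht)).sqrt
  rw [minkowskiForm_homogenize hξ hη, mul_div_cancel₀ _ two_ne_zero, ← mul_pow, ← mul_pow,
    Real.sqrt_sq (mul_nonneg (mul_nonneg dist_nonneg (visualScale_pos o hξ).le)
      (visualScale_pos o hη).le)] at hsq
  refine hsq.congr fun n => ?_
  rw [Real.sqrt_eq_iff_mul_self_eq_of_pos (Real.exp_pos _), ← sq]
  have hsn := (s n).time_pos.ne'
  have htn := (t n).time_pos.ne'
  rw [← Real.exp_nat_mul, Nat.cast_ofNat, mul_neg, exp_neg_two_mul_gromovProduct]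
  field_simp

theorem tendsto_gromovProduct_atTop (o : Hyperboloid E) {s t : α → Hyperboloid E} {ξ : E}
    (hξ : ‖ξ‖ = 1) (hs : Tendsto (fun n => klein (s n)) l (𝓝 ξ))
    (ht : Tendsto (fun n => klein (t n)) l (𝓝 ξ)) :
    Tendsto (fun n => gromovProduct o (s n) (t n)) l atTop := by
  have hexp := tendsto_exp_neg_gromovProduct o hξ hξ hs ht
  rwa [dist_self, zero_mul, zero_mul, Real.tendsto_exp_comp_nhds_zero,
    tendsto_neg_atBot_iff] at hexp

theorem tendsto_dist_klein_of_tendsto_gromovProduct {s t : α → Hyperboloid E}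
    (h : Tendsto (fun n => gromovProduct origin (s n) (t n)) l atTop) :
    Tendsto (fun n => dist (klein (s n)) (klein (t n))) l (𝓝 0) := by
  have hexp : Tendsto (fun n => Real.exp (-(2 * gromovProduct origin (s n) (t n)))) l (𝓝 0) := by
    rw [Real.tendsto_exp_comp_nhds_zero, tendsto_neg_atBot_iff]
    exact h.const_mul_atTop two_pos
  have hsq := squeeze_zero (fun n => sq_nonneg (dist (klein (s n)) (klein (t n))))
    (fun n => dist_klein_sq_le _ _) (by simpa only [mul_zero] using hexp.const_mul 8)
  simpa only [Real.sqrt_sq dist_nonneg, Real.sqrt_zero] using hsq.sqrt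

theorem convergesToInfinity_of_tendsto_klein {s : ℕ → Hyperboloid E} {ξ : E} (hξ : ‖ξ‖ = 1)
    (hs : Tendsto (fun n => klein (s n)) atTop (𝓝 ξ)) : ConvergesToInfinity s := fun o =>
  tendsto_gromovProduct_atTop o hξ (hs.comp tendsto_fst_atTop_prod) (hs.comp tendsto_snd_atTop_prod)

theorem tendsto_norm_klein_of_convergesToInfinity {s : ℕ → Hyperboloid E}
    (hs : ConvergesToInfinity s) : Tendsto (fun n => ‖klein (s n)‖) atTop (𝓝 1) := by
  have hexp : Tendsto (fun n => Real.exp (-(2 * gromovProduct origin (s n) (s n)))) atTop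
      (𝓝 0) := by
    rw [Real.tendsto_exp_comp_nhds_zero, tendsto_neg_atBot_iff]
    exact ((hs origin).comp tendsto_atTop_diagonal).const_mul_atTop two_pos
  have hgap : Tendsto (fun n => 1 - ‖klein (s n)‖ ^ 2) atTop (𝓝 0) := by
    refine squeeze_zero (fun n => sub_nonneg.2 (norm_klein_sq_le_one _)) (fun n => ?_)
      (by simpa only [mul_zero] using hexp.const_mul 4)
    rw [← real_inner_self_eq_norm_sq]
    exact one_sub_inner_klein_le _ _
  simpa using (hgap.const_sub 1).sqrt

theorem exists_tendsto_klein [CompleteSpace E] {s : ℕ → Hyperboloid E}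
    (hs : ConvergesToInfinity s) :
    ∃ ξ : E, ‖ξ‖ = 1 ∧ Tendsto (fun n => klein (s n)) atTop (𝓝 ξ) := by
  have hdist : Tendsto (fun p : ℕ × ℕ => dist (klein (s p.1)) (klein (s p.2))) atTop (𝓝 0) :=
    tendsto_dist_klein_of_tendsto_gromovProduct (hs origin)
  have hcauchy : CauchySeq fun n => klein (s n) := cauchySeq_iff_tendsto_dist_atTop_0.2 hdist
  obtain ⟨ξ, hξ⟩ := cauchySeq_tendsto_of_complete hcauchy
  exact ⟨ξ, tendsto_nhds_unique hξ.norm (tendsto_norm_klein_of_convergesToInfinity hs), hξ⟩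

/-- The unit vector which is the limit, in the projective model, of a sequence converging to
infinity. -/
def limitDirection [CompleteSpace E] (s : InfinitySeq (Hyperboloid E)) : E :=
  (exists_tendsto_klein s.2).choose

theorem norm_limitDirection [CompleteSpace E] (s : InfinitySeq (Hyperboloid E)) :
    ‖limitDirection s‖ = 1 :=
  (exists_tendsto_klein s.2).choose_spec.1

theorem tendsto_klein_limitDirection [CompleteSpace E] (s : InfinitySeq (Hyperboloid E)) :
    Tendsto (fun n => klein (s.1 n)) atTop (𝓝 (limitDirection s)) :=
  (exists_tendsto_klein s.2).choose_spec.2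

theorem equivalent_iff_limitDirection_eq [CompleteSpace E] {s t : InfinitySeq (Hyperboloid E)} :
    s.Equivalent t ↔ limitDirection s = limitDirection t := by
  have hs := (tendsto_klein_limitDirection s).comp (tendsto_fst_atTop_prod (β := ℕ))
  have ht := (tendsto_klein_limitDirection t).comp (tendsto_snd_atTop_prod (α := ℕ))
  refine ⟨fun h => dist_eq_zero.1 ?_, fun h o => ?_⟩
  · exact tendsto_nhds_unique (hs.dist ht)
      (tendsto_dist_klein_of_tendsto_gromovProduct (h origin))
  · exact tendsto_gromovProduct_atTop o (norm_limitDirection s) hs (h ▸ ht)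

theorem homogenize_mem_futureCone {ξ : E} (hξ : ‖ξ‖ < 1) : homogenize ξ ∈ futureCone E := by
  refine ⟨one_pos, ?_⟩
  rw [minkowskiForm_self, homogenize, one_pow, sub_pos]
  exact pow_lt_one₀ (norm_nonneg ξ) hξ two_ne_zero

theorem exists_seq_tendsto_klein {ξ : E} (hξ : ‖ξ‖ = 1) :
    ∃ s : ℕ → Hyperboloid E, Tendsto (fun n => klein (s n)) atTop (𝓝 ξ) := by
  have hball (n : ℕ) : ‖((n : ℝ) / (n + 1)) • ξ‖ < 1 := by
    rw [norm_smul, hξ, mul_one, Real.norm_of_nonneg (by positivity), div_lt_one (by positivity)]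
    exact lt_add_one _
  refine ⟨fun n => normalize (homogenize _) (homogenize_mem_futureCone (hball n)), ?_⟩
  simpa [klein_normalize, homogenize] using
    (tendsto_natCast_div_add_atTop (1 : ℝ)).smul_const ξ

end Hyperboloid

/-- The cross-ratio of a function `δ` of two variables, which the visual distances define on the
boundary. -/
def crossRatioOf {Z : Type*} (δ : Z → Z → ℝ≥0∞) (a b c d : Z) : ℝ≥0∞ :=
  (δ a b * δ c d) / (δ a d * δ c b)

theorem crossRatioOf_rescale {Z : Type*} {δ δ' : Z → Z → ℝ≥0∞} {k : Z → ℝ≥0∞}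
    (h : ∀ x y, δ' x y = δ x y * k x * k y) (hk : ∀ x, k x ≠ 0) (hk' : ∀ x, k x ≠ ∞) :
    crossRatioOf δ' = crossRatioOf δ := by
  have hfactor (x y z w : Z) :
      δ' x y * δ' z w = δ x y * δ z w * (k x * k y * k z * k w) := by
    rw [h, h]
    ring
  funext a b c d
  have hperm : k a * k d * k c * k b = k a * k b * k c * k d := by ring
  rw [crossRatioOf, hfactor, hfactor, hperm]
  refine ENNReal.mul_div_mul_right _ _ ?_ ?_
  · simp only [ne_eq, mul_eq_zero, hk, or_self, not_false_eq_true]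
  · exact ENNReal.mul_ne_top (ENNReal.mul_ne_top (ENNReal.mul_ne_top (hk' _) (hk' _)) (hk' _))
      (hk' _)

namespace GromovBoundary

open Hyperboloid

variable {E : Type*} [NormedAddCommGroup E] [InnerProductSpace ℝ E] [CompleteSpace E]

/-- The unit vector which represents a boundary point of the hyperboloid. -/
def direction : GromovBoundary (Hyperboloid E) → E :=
  Quot.lift limitDirection fun _ _ => equivalent_iff_limitDirection_eq.1

theorem direction_injective : Function.Injective (direction (E := E)) := by
  intro ξ η h
  obtain ⟨s, rfl⟩ := ξ.exists_limit_eq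
  obtain ⟨t, rfl⟩ := η.exists_limit_eq
  exact Quot.sound (equivalent_iff_limitDirection_eq.2 h)

theorem norm_direction (ζ : GromovBoundary (Hyperboloid E)) : ‖direction ζ‖ = 1 := by
  obtain ⟨s, rfl⟩ := ζ.exists_limit_eq
  exact norm_limitDirection s

theorem tendsto_klein {s : InfinitySeq (Hyperboloid E)} {ζ : GromovBoundary (Hyperboloid E)}
    (h : s.limit = ζ) : Tendsto (fun n => klein (s.1 n)) atTop (𝓝 (direction ζ)) :=
  h ▸ tendsto_klein_limitDirection s

theorem convergesToBoundary_iff {s : ℕ → Hyperboloid E} {ζ : GromovBoundary (Hyperboloid E)} :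
    ConvergesToBoundary s ζ ↔ Tendsto (fun n => klein (s n)) atTop (𝓝 (direction ζ)) := by
  refine ⟨fun ⟨_, h⟩ => tendsto_klein h, fun h => ?_⟩
  have hs := convergesToInfinity_of_tendsto_klein (norm_direction ζ) h
  exact ⟨hs, direction_injective (tendsto_nhds_unique (tendsto_klein_limitDirection ⟨s, hs⟩) h)⟩

theorem exists_direction_eq {ξ : E} (hξ : ‖ξ‖ = 1) :
    ∃ ζ : GromovBoundary (Hyperboloid E), direction ζ = ξ := by
  obtain ⟨s, hs⟩ := exists_seq_tendsto_klein hξ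
  exact ⟨InfinitySeq.limit ⟨s, convergesToInfinity_of_tendsto_klein hξ hs⟩,
    tendsto_nhds_unique (tendsto_klein_limitDirection _) hs⟩

/-- The isotropic vector `(1, direction ζ)` which represents a boundary point of the
hyperboloid. -/
def lightVector (ζ : GromovBoundary (Hyperboloid E)) : ℝ × E := homogenize (direction ζ)

theorem minkowskiForm_lightVector (ξ η : GromovBoundary (Hyperboloid E)) :
    ⟪lightVector ξ, lightVector η⟫ₘ = dist (direction ξ) (direction η) ^ 2 / 2 :=
  minkowskiForm_homogenize (norm_direction ξ) (norm_direction η)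

theorem minkowskiForm_lightVector_self (ζ : GromovBoundary (Hyperboloid E)) :
    ⟪lightVector ζ, lightVector ζ⟫ₘ = 0 := by
  rw [minkowskiForm_lightVector, dist_self, zero_pow two_ne_zero, zero_div]

theorem minkowskiForm_lightVector_pos {v : ℝ × E} (hv : v ∈ futureCone E)
    (ζ : GromovBoundary (Hyperboloid E)) : 0 < ⟪v, lightVector ζ⟫ₘ :=
  minkowskiForm_homogenize_pos hv (norm_direction ζ)

theorem visualDist_eq (o : Hyperboloid E) (ξ η : GromovBoundary (Hyperboloid E)) :
    visualDist o ξ η = edist (direction ξ) (direction η) *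
      ENNReal.ofReal (visualScale o (direction ξ)) *
      ENNReal.ofReal (visualScale o (direction η)) := by
  rw [edist_dist, ← ENNReal.ofReal_mul dist_nonneg, ← ENNReal.ofReal_mul
    (mul_nonneg dist_nonneg (visualScale_pos o (norm_direction ξ)).le)]
  exact visualDist_eq_of_tendsto fun s t hs ht =>
    tendsto_exp_neg_gromovProduct o (norm_direction ξ) (norm_direction η)
      ((tendsto_klein hs).comp tendsto_fst_atTop_prod)
      ((tendsto_klein ht).comp tendsto_snd_atTop_prod)

theorem boundaryCrossRatio_eq (o : Hyperboloid E) :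
    boundaryCrossRatio o =
      crossRatioOf fun ξ η : GromovBoundary (Hyperboloid E) => edist (direction ξ) (direction η) :=
  crossRatioOf_rescale (visualDist_eq o)
    (fun ξ => (ENNReal.ofReal_pos.2 (visualScale_pos o (norm_direction ξ))).ne')
    fun _ => ENNReal.ofReal_ne_top

theorem tendsto_visualDist {α : Type*} {l : Filter α} {f : α → GromovBoundary (Hyperboloid E)}
    {ξ : GromovBoundary (Hyperboloid E)}
    (hf : Tendsto (fun n => direction (f n)) l (𝓝 (direction ξ))) :
    Tendsto (fun n => visualDist origin ξ (f n)) l (𝓝 0) := by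
  have hdist : Tendsto (fun n => edist (direction ξ) (direction (f n))) l (𝓝 0) := by
    rw [← edist_self (direction ξ)]
    exact tendsto_const_nhds.edist hf
  simp only [visualDist_eq, visualScale, minkowskiForm_origin_homogenize]
  simpa only [zero_mul] using ENNReal.Tendsto.mul_const
    (ENNReal.Tendsto.mul_const hdist (Or.inr ENNReal.ofReal_ne_top))
    (Or.inr ENNReal.ofReal_ne_top)

theorem continuous_of_continuous_direction {Y : Type*} [TopologicalSpace Y]
    {f : Y → GromovBoundary (Hyperboloid E)} (hf : Continuous fun y => direction (f y)) :
    Continuous f := by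
  refine continuous_def.2 fun U hU => isOpen_iff_mem_nhds.2 fun y hy => ?_
  obtain ⟨r, hr, hU⟩ := hU (f y) hy origin
  have hpos : 0 < EReal.exp (-(r : EReal)) := by
    rw [EReal.zero_lt_exp_iff, bot_lt_iff_ne_bot, ne_eq, EReal.neg_eq_bot_iff]
    simpa using hr.ne
  filter_upwards [(tendsto_visualDist (hf.tendsto y)).eventually_lt_const hpos] with z hz
  refine hU _ ?_
  rwa [visualDist, EReal.exp_lt_exp_iff, EReal.neg_lt_neg_iff,
    EReal.coe_ennreal_lt_coe_ennreal_iff] at hz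

end GromovBoundary

/-! ### Total sets and dense spans -/

section Total

variable {E : Type*} [NormedAddCommGroup E] [InnerProductSpace ℝ E]

/-- Two future isotropic vectors with product `1 / 2`. They are the ends of the geodesic line
`r ↦ exp (-r) • p + exp r • q` of the hyperboloid. -/
structure IsNullFrame (p q : ℝ × E) : Prop where
  left_fst_pos : 0 < p.1
  right_fst_pos : 0 < q.1
  left_self : ⟪p, p⟫ₘ = 0
  right_self : ⟪q, q⟫ₘ = 0
  left_right : ⟪p, q⟫ₘ = 1 / 2

namespace IsNullFrame

open Hyperboloid

variable {p q : ℝ × E}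

theorem symm (h : IsNullFrame p q) : IsNullFrame q p :=
  ⟨h.right_fst_pos, h.left_fst_pos, h.right_self, h.left_self,
    minkowskiForm_comm q p ▸ h.left_right⟩

theorem minkowskiForm_smul_add_smul (h : IsNullFrame p q) (a b c d : ℝ) :
    ⟪a • p + b • q, c • p + d • q⟫ₘ = (a * d + b * c) / 2 := by
  simp only [map_add, map_smul, add_apply, smul_apply, smul_eq_mul, h.left_self, h.right_self,
    h.left_right, h.symm.left_right]
  ring

/-- The geodesic line of a null frame. -/
def line (h : IsNullFrame p q) (r : ℝ) : Hyperboloid E :=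
  ofVec (Real.exp (-r) • p + Real.exp r • q)
    (add_pos (mul_pos (Real.exp_pos _) h.left_fst_pos) (mul_pos (Real.exp_pos _) h.right_fst_pos))
    (by rw [h.minkowskiForm_smul_add_smul, ← Real.exp_add, ← Real.exp_add, neg_add_cancel,
      add_neg_cancel, Real.exp_zero, add_self_div_two])

theorem vec_line (h : IsNullFrame p q) (r : ℝ) :
    (h.line r).vec = Real.exp (-r) • p + Real.exp r • q := rfl

theorem line_neg (h : IsNullFrame p q) (r : ℝ) : h.line (-r) = h.symm.line r :=
  vec_injective <| by rw [vec_line, vec_line, neg_neg, add_comm]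

theorem form_line (h : IsNullFrame p q) (r s : ℝ) :
    form (h.line r) (h.line s) = Real.cosh (r - s) := by
  rw [form_eq_minkowskiForm, vec_line, vec_line, h.minkowskiForm_smul_add_smul, Real.cosh_eq,
    ← Real.exp_add, ← Real.exp_add]
  ring_nf

theorem isometry_line (h : IsNullFrame p q) : Isometry h.line :=
  Isometry.of_dist_eq fun r s => Real.cosh_injOn dist_nonneg dist_nonneg <| by
    rw [cosh_dist, form_line, Real.dist_eq, Real.cosh_abs]

theorem vec_line_mem (h : IsNullFrame p q) {W : Submodule ℝ (ℝ × E)} (hp : p ∈ W) (hq : q ∈ W)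
    (r : ℝ) : (h.line r).vec ∈ W :=
  W.add_mem (W.smul_mem _ hp) (W.smul_mem _ hq)

theorem right_mem (h : IsNullFrame p q) {W : Submodule ℝ (ℝ × E)} {a b : ℝ} (hab : a ≠ b)
    (ha : (h.line a).vec ∈ W) (hb : (h.line b).vec ∈ W) : q ∈ W := by
  have hcomb : Real.exp (-b) • (h.line a).vec - Real.exp (-a) • (h.line b).vec =
      (Real.exp (a - b) - Real.exp (b - a)) • q := by
    simp only [vec_line, Real.exp_neg, Real.exp_sub]
    module
  have hne : Real.exp (a - b) - Real.exp (b - a) ≠ 0 := by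
    rw [sub_ne_zero, Real.exp_injective.ne_iff]
    intro h
    exact hab (by linarith)
  rw [← W.smul_mem_iff hne, ← hcomb]
  exact W.sub_mem (W.smul_mem _ ha) (W.smul_mem _ hb)

theorem left_mem (h : IsNullFrame p q) {W : Submodule ℝ (ℝ × E)} {a b : ℝ} (hab : a ≠ b)
    (ha : (h.line a).vec ∈ W) (hb : (h.line b).vec ∈ W) : p ∈ W :=
  h.symm.right_mem (neg_injective.ne hab) (by rwa [← line_neg, neg_neg])
    (by rwa [← line_neg, neg_neg])

theorem eq_line_of_isometry (h : IsNullFrame p q) {γ : ℝ → Hyperboloid E} (hγ : Isometry γ)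
    {a b : ℝ} (hab : a ≠ b) (ha : γ a = h.line a) (hb : γ b = h.line b) : γ = h.line := by
  funext r
  have horth {t : ℝ} (ht : γ t = h.line t) :
      (h.line t).vec ∈ (minkowskiForm ((γ r).vec - (h.line r).vec)).ker := by
    change ⟪_, _⟫ₘ = 0
    rw [map_sub, sub_apply, ← form_eq_minkowskiForm, ← form_eq_minkowskiForm, form_line, ← ht,
      ← cosh_dist, hγ.dist_eq, Real.dist_eq, Real.cosh_abs, sub_self]
  have hr : ⟪(γ r).vec - (h.line r).vec, (h.line r).vec⟫ₘ = 0 :=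
    h.vec_line_mem (h.left_mem hab (horth ha) (horth hb)) (h.right_mem hab (horth ha) (horth hb)) r
  rw [map_sub, sub_apply, minkowskiForm_vec_self, sub_eq_zero] at hr
  exact eq_of_form_eq_one _ _ (by rw [form_eq_minkowskiForm, hr])

theorem exists_line_eq_normalize (h : IsNullFrame p q) {a b : ℝ}
    (hv : a • p + b • q ∈ futureCone E) : ∃ r, h.line r = normalize _ hv := by
  have hmul := hv.2
  rw [h.minkowskiForm_smul_add_smul] at hmul
  have hleft := minkowskiForm_pos_of_mem_futureCone hv h.left_fst_pos h.left_self.ge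
  have hright := minkowskiForm_pos_of_mem_futureCone hv h.right_fst_pos h.right_self.ge
  simp only [map_add, map_smul, add_apply, smul_apply, smul_eq_mul, h.left_self, h.right_self,
    h.left_right, h.symm.left_right] at hleft hright
  obtain ⟨α, rfl⟩ : ∃ α, Real.exp α = a := ⟨Real.log a, Real.exp_log (by linarith)⟩
  obtain ⟨β, rfl⟩ : ∃ β, Real.exp β = b := ⟨Real.log b, Real.exp_log (by linarith)⟩
  refine ⟨(β - α) / 2, vec_injective ?_⟩
  rw [vec_normalize, h.minkowskiForm_smul_add_smul, mul_comm (Real.exp β), add_self_div_two,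
    ← Real.exp_add, ← Real.exp_half, ← Real.exp_neg, smul_add, smul_smul, smul_smul,
    ← Real.exp_add, ← Real.exp_add, vec_line]
  ring_nf

theorem tendsto_klein_line (h : IsNullFrame p q) :
    Tendsto (fun n : ℕ => klein (h.line n)) atTop (𝓝 (q.1⁻¹ • q.2)) := by
  have hexp : Tendsto (fun n : ℕ => Real.exp (-(n : ℝ))) atTop (𝓝 0) :=
    Real.tendsto_exp_neg_atTop_nhds_zero.comp tendsto_natCast_atTop_atTop
  refine tendsto_klein_of_tendsto_smul_vec (s := fun n : ℕ => h.line n)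
    (c := fun n => Real.exp (-n)) h.right_fst_pos.ne' ?_
  have hlim := ((hexp.mul hexp).smul_const p).add_const q
  rw [mul_zero, zero_smul, zero_add] at hlim
  refine hlim.congr fun n => ?_
  rw [vec_line, smul_add, smul_smul, smul_smul, ← Real.exp_add (-(n : ℝ)) n, neg_add_cancel,
    Real.exp_zero, one_smul]

end IsNullFrame

namespace Hyperboloid

theorem minkowskiForm_smul_vec_add_smul_vec (x y : Hyperboloid E) (a b c d : ℝ) :
    ⟪a • x.vec + b • y.vec, c • x.vec + d • y.vec⟫ₘ =
      a * c + b * d + (a * d + b * c) * Real.cosh (dist x y) := by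
  simp only [map_add, map_smul, add_apply, smul_apply, smul_eq_mul, minkowskiForm_vec_self,
    minkowskiForm_comm y.vec x.vec, ← form_eq_minkowskiForm x y, ← cosh_dist]
  ring

theorem exists_isNullFrame_of_ne {x y : Hyperboloid E} (hxy : x ≠ y) :
    ∃ (p q : ℝ × E) (h : IsNullFrame p q), h.line 0 = x ∧ h.line (dist x y) = y := by
  set a := Real.exp (dist x y) with ha
  set b := Real.exp (-dist x y) with hb
  have hcosh : Real.cosh (dist x y) = (a + b) / 2 := Real.cosh_eq _
  have hab : a * b = 1 := by rw [ha, hb, ← Real.exp_add, add_neg_cancel, Real.exp_zero]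
  have hne : a - b ≠ 0 := (sub_pos.2 (Real.exp_lt_exp.2 (neg_lt_self (dist_pos.2 hxy)))).ne'
  obtain ⟨c, hc⟩ : ∃ c, c * (a - b) = 1 := ⟨_, inv_mul_cancel₀ hne⟩
  set p := (c * a) • x.vec + (-c) • y.vec with hp
  set q := (-(c * b)) • x.vec + c • y.vec with hq
  have hpp : ⟪p, p⟫ₘ = 0 := by
    rw [hp, minkowskiForm_smul_vec_add_smul_vec, hcosh]
    linear_combination -c ^ 2 * hab
  have hqq : ⟪q, q⟫ₘ = 0 := by
    rw [hq, minkowskiForm_smul_vec_add_smul_vec, hcosh]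
    linear_combination -c ^ 2 * hab
  have hpq : ⟪p, q⟫ₘ = 1 / 2 := by
    rw [hp, hq, minkowskiForm_smul_vec_add_smul_vec, hcosh]
    linear_combination (c * (a - b) + 1) / 2 * hc + c ^ 2 * hab
  have hx : p + q = x.vec := by
    rw [← one_smul ℝ x.vec, ← hc, hp, hq]
    module
  have hy : b • p + a • q = y.vec := by
    rw [← one_smul ℝ y.vec, ← hc, hp, hq]
    module
  clear_value p q
  have hxp : ⟪x.vec, p⟫ₘ = 1 / 2 := by
    rw [← hx, map_add, add_apply, hpp, minkowskiForm_comm, hpq, zero_add]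
  have hxq : ⟪x.vec, q⟫ₘ = 1 / 2 := by
    rw [← hx, map_add, add_apply, hqq, hpq, add_zero]
  have hpos {w : ℝ × E} (hw : ⟪w, w⟫ₘ = 0) (hxw : ⟪x.vec, w⟫ₘ = 1 / 2) : 0 < w.1 :=
    fst_pos_of_minkowskiForm_pos x.vec_mem_futureCone hw.ge (by norm_num [hxw])
  have h : IsNullFrame p q := ⟨hpos hpp hxp, hpos hqq hxq, hpp, hqq, hpq⟩
  exact ⟨p, q, h, vec_injective (by simpa [IsNullFrame.vec_line] using hx), vec_injective hy⟩

theorem exists_isNullFrame_of_isometry {γ : ℝ → Hyperboloid E} (hγ : Isometry γ) :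
    ∃ (p q : ℝ × E) (h : IsNullFrame p q), γ = h.line := by
  obtain ⟨p, q, h, hline0, hline1⟩ := exists_isNullFrame_of_ne (hγ.injective.ne zero_ne_one)
  rw [hγ.dist_eq, dist_zero_left, norm_one] at hline1
  exact ⟨p, q, h, h.eq_line_of_isometry hγ zero_ne_one hline0.symm hline1.symm⟩

theorem isTotallyGeodesic_preimage (W : Submodule ℝ (ℝ × E)) :
    IsTotallyGeodesic {x : Hyperboloid E | x.vec ∈ W} := by
  intro γ hγ a b hab ha hb r
  obtain ⟨p, q, h, rfl⟩ := exists_isNullFrame_of_isometry hγ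
  exact h.vec_line_mem (h.left_mem hab ha hb) (h.right_mem hab ha hb) r

theorem normalize_smul_vec {t : ℝ} (ht : 0 < t) (x : Hyperboloid E) :
    normalize (t • x.vec) (smul_mem_futureCone ht x.vec_mem_futureCone) = x := by
  have hsq : ⟪t • x.vec, t • x.vec⟫ₘ = t * t := by
    simp only [map_smul, smul_apply, smul_eq_mul, minkowskiForm_vec_self, mul_one]
  exact vec_injective (by
    rw [vec_normalize, hsq, Real.sqrt_mul_self ht.le, inv_smul_smul₀ ht.ne'])

theorem normalize_vec (x : Hyperboloid E) : normalize x.vec x.vec_mem_futureCone = x := by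
  have h := normalize_smul_vec one_pos x
  simpa only [one_smul] using h

theorem normalize_mem_of_isTotallyGeodesic {S : Set (Hyperboloid E)} (hS : IsTotallyGeodesic S)
    {x y : Hyperboloid E} (hx : x ∈ S) (hy : y ∈ S) {a b : ℝ}
    (hv : a • x.vec + b • y.vec ∈ futureCone E) : normalize _ hv ∈ S := by
  rcases eq_or_ne x y with rfl | hxy
  · have hsum : a • x.vec + b • x.vec = (a + b) • x.vec := (add_smul a b x.vec).symm
    have hpos : 0 < a + b :=
      pos_of_mul_pos_left (hv.1.trans_eq (congrArg Prod.fst hsum)) x.time_pos.le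
    simpa only [hsum, normalize_smul_vec hpos] using hx
  · obtain ⟨p, q, h, hline0, hline1⟩ := exists_isNullFrame_of_ne hxy
    have hcomb : a • x.vec + b • y.vec =
        (a + b * Real.exp (-dist x y)) • p + (a + b * Real.exp (dist x y)) • q := by
      rw [← congrArg vec hline0, ← congrArg vec hline1, h.vec_line, h.vec_line, neg_zero,
        Real.exp_zero]
      module
    obtain ⟨r, hr⟩ := h.exists_line_eq_normalize (hcomb ▸ hv)
    simp only [hcomb, ← hr]
    exact hS h.line h.isometry_line 0 (dist x y) (dist_pos.2 hxy).ne (by rwa [hline0])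
      (by rwa [hline1]) r

/-- The cone of the Minkowski space over a set of points of the hyperboloid. -/
def coneOver (S : Set (Hyperboloid E)) : Set (ℝ × E) :=
  {v | ∃ hv : v ∈ futureCone E, normalize v hv ∈ S}

theorem vec_mem_coneOver {S : Set (Hyperboloid E)} {x : Hyperboloid E} (hx : x ∈ S) :
    x.vec ∈ coneOver S :=
  ⟨x.vec_mem_futureCone, by rwa [normalize_vec]⟩

theorem smul_add_smul_mem_coneOver {S : Set (Hyperboloid E)} (hS : IsTotallyGeodesic S)
    {v w : ℝ × E} (hv : v ∈ coneOver S) (hw : w ∈ coneOver S) {a b : ℝ}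
    (h : a • v + b • w ∈ futureCone E) : a • v + b • w ∈ coneOver S := by
  obtain ⟨hv, hvS⟩ := hv
  obtain ⟨hw, hwS⟩ := hw
  refine ⟨h, ?_⟩
  have hcomb : a • v + b • w = (a * √⟪v, v⟫ₘ) • (normalize v hv).vec +
      (b * √⟪w, w⟫ₘ) • (normalize w hw).vec := by
    rw [mul_smul, mul_smul, smul_vec_normalize, smul_vec_normalize]
  simp only [hcomb]
  exact normalize_mem_of_isTotallyGeodesic hS hvS hwS (hcomb ▸ h)

theorem smul_mem_coneOver {S : Set (Hyperboloid E)} (hS : IsTotallyGeodesic S) {t : ℝ}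
    (ht : 0 < t) {v : ℝ × E} (hv : v ∈ coneOver S) : t • v ∈ coneOver S := by
  have h := smul_add_smul_mem_coneOver hS hv hv (a := t) (b := 0)
  rw [zero_smul, add_zero] at h
  exact h (smul_mem_futureCone ht hv.1)

theorem add_mem_coneOver {S : Set (Hyperboloid E)} (hS : IsTotallyGeodesic S)
    {v w : ℝ × E} (hv : v ∈ coneOver S) (hw : w ∈ coneOver S) : v + w ∈ coneOver S := by
  have h := smul_add_smul_mem_coneOver hS hv hw (a := 1) (b := 1)
  rw [one_smul, one_smul] at h
  exact h (add_mem_futureCone hv.1 hw.1)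

theorem exists_add_mem_coneOver {S : Set (Hyperboloid E)} (hS : IsTotallyGeodesic S)
    (hne : S.Nonempty) {v : ℝ × E} (hv : v ∈ Submodule.span ℝ (vec '' S)) :
    ∃ c ∈ coneOver S, v + c ∈ coneOver S := by
  obtain ⟨x₀, hx₀⟩ := hne
  induction hv using Submodule.span_induction with
  | mem v hv =>
    obtain ⟨x, hx, rfl⟩ := hv
    exact ⟨_, vec_mem_coneOver hx, add_mem_coneOver hS (vec_mem_coneOver hx) (vec_mem_coneOver hx)⟩
  | zero => exact ⟨_, vec_mem_coneOver hx₀, by simpa using vec_mem_coneOver hx₀⟩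
  | add v w _ _ hv hw =>
    obtain ⟨c, hc, hvc⟩ := hv
    obtain ⟨d, hd, hwd⟩ := hw
    exact ⟨_, add_mem_coneOver hS hc hd, add_add_add_comm v w c d ▸ add_mem_coneOver hS hvc hwd⟩
  | smul r v _ hv =>
    obtain ⟨c, hc, hvc⟩ := hv
    rcases lt_trichotomy r 0 with hr | rfl | hr
    · refine ⟨_, smul_mem_coneOver hS (neg_pos.2 hr) hvc, ?_⟩
      convert smul_mem_coneOver hS (neg_pos.2 hr) hc using 1
      module
    · exact ⟨c, hc, by simpa using hc⟩
    · exact ⟨_, smul_mem_coneOver hS hr hc, smul_add r v c ▸ smul_mem_coneOver hS hr hvc⟩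

theorem normalize_mem_of_mem_span {S : Set (Hyperboloid E)} (hS : IsTotallyGeodesic S)
    {v : ℝ × E} (hv : v ∈ futureCone E) (hspan : v ∈ Submodule.span ℝ (vec '' S)) :
    normalize v hv ∈ S := by
  have hne : S.Nonempty := by
    rw [Set.nonempty_iff_ne_empty]
    rintro rfl
    rw [Set.image_empty, Submodule.span_empty, Submodule.mem_bot] at hspan
    exact hv.1.ne' (by rw [hspan, Prod.fst_zero])
  obtain ⟨c, hc, hvc⟩ := exists_add_mem_coneOver hS hne hspan
  have h := smul_add_smul_mem_coneOver hS hvc hc (a := 1) (b := -1)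
  rw [one_smul, neg_one_smul, add_neg_cancel_right] at h
  exact (h hv).2

theorem norm_space_sub_sq (x y : Hyperboloid E) :
    ‖x.space - y.space‖ ^ 2 = (x.time - y.time) ^ 2 + 2 * (Real.cosh (dist x y) - 1) := by
  rw [cosh_dist, form, norm_sub_sq_real]
  linear_combination -x.form_eq_one - y.form_eq_one

theorem continuous_vec : Continuous (vec : Hyperboloid E → ℝ × E) := by
  have htime : Continuous (time : Hyperboloid E → ℝ) := by
    have h : Continuous fun x : Hyperboloid E => Real.cosh (dist origin x) := by fun_prop
    simpa only [cosh_dist, form_origin] using h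
  refine htime.prodMk (continuous_iff_continuousAt.2 fun x =>
    tendsto_iff_norm_sub_tendsto_zero.2 ?_)
  have hsq : Continuous fun y : Hyperboloid E => ‖y.space - x.space‖ ^ 2 := by
    simp only [norm_space_sub_sq]
    fun_prop
  simpa using (hsq.sqrt.tendsto x)

theorem tendsto_of_tendsto_vec {α : Type*} {l : Filter α} {s : α → Hyperboloid E}
    {x : Hyperboloid E} (h : Tendsto (fun n => (s n).vec) l (𝓝 x.vec)) : Tendsto s l (𝓝 x) := by
  have hform : Tendsto (fun n => form (s n) x) l (𝓝[Set.Ici 1] 1) := by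
    refine tendsto_nhdsWithin_iff.2 ⟨?_, .of_forall fun n => one_le_form _ _⟩
    simpa only [form_eq_minkowskiForm, minkowskiForm_vec_self] using
      tendsto_minkowskiForm h (tendsto_const_nhds (x := x.vec))
  have harcosh := (Real.continuousOn_arcosh 1 Set.self_mem_Ici).tendsto.comp hform
  rw [Real.arcosh_zero] at harcosh
  exact tendsto_iff_dist_tendsto_zero.2 harcosh

theorem isInducing_vec : IsInducing (vec : Hyperboloid E → ℝ × E) :=
  isInducing_iff_nhds.2 fun _ => le_antisymm continuous_vec.continuousAt.le_comap
    (tendsto_of_tendsto_vec tendsto_comap)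

theorem continuous_normalize : Continuous fun v : futureCone E => normalize v.1 v.2 := by
  have hcont : Continuous fun v : futureCone E => (√⟪v.1, v.1⟫ₘ)⁻¹ • v.1 :=
    (((continuous_minkowskiForm.comp (continuous_subtype_val.prodMk continuous_subtype_val)).sqrt
      ).inv₀ fun v => (Real.sqrt_pos.2 v.2.2).ne').smul continuous_subtype_val
  exact isInducing_vec.continuous_iff.2 hcont

theorem eq_univ_of_dense_span {S : Set (Hyperboloid E)} (hS : IsTotallyGeodesic S)
    (hclosed : IsClosed S) (hdense : Dense (Submodule.span ℝ (vec '' S) : Set (ℝ × E))) :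
    S = Set.univ := by
  have hcone : Dense (Subtype.val ⁻¹' (Submodule.span ℝ (vec '' S)) : Set (futureCone E)) :=
    hdense.preimage isOpen_futureCone.isOpenMap_subtype_val
  have hmem (v : futureCone E) : normalize v.1 v.2 ∈ S :=
    (hclosed.preimage continuous_normalize).closure_subset_iff.2
      (fun w hw => normalize_mem_of_mem_span hS w.2 hw) (hcone v)
  refine Set.eq_univ_of_forall fun x => ?_
  exact normalize_vec x ▸ hmem ⟨x.vec, x.vec_mem_futureCone⟩

theorem span_range_vec : Submodule.span ℝ (Set.range (vec : Hyperboloid E → ℝ × E)) = ⊤ := by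
  refine Submodule.eq_top_of_nonempty_interior' _
    ⟨origin.vec, mem_interior.2 ⟨futureCone E, fun v hv => ?_, isOpen_futureCone,
      origin.vec_mem_futureCone⟩⟩
  rw [SetLike.mem_coe, ← smul_vec_normalize v hv]
  exact Submodule.smul_mem _ _ (Submodule.subset_span ⟨_, rfl⟩)

end Hyperboloid

namespace GromovBoundary

open Hyperboloid

variable [CompleteSpace E]

theorem eq_smul_lightVector_iff {v : ℝ × E} (hv : v.1 ≠ 0) {ζ : GromovBoundary (Hyperboloid E)} :
    v = v.1 • lightVector ζ ↔ v.1⁻¹ • v.2 = direction ζ := by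
  rw [inv_smul_eq_iff₀ hv, Prod.ext_iff]
  exact and_iff_right (mul_one v.1).symm

theorem isGeodesicLine_line_iff {p q : ℝ × E} (h : IsNullFrame p q)
    {ξ η : GromovBoundary (Hyperboloid E)} :
    IsGeodesicLine h.line ξ η ↔ p = p.1 • lightVector ξ ∧ q = q.1 • lightVector η := by
  have hconv {p q : ℝ × E} (h : IsNullFrame p q) {ζ : GromovBoundary (Hyperboloid E)} :
      ConvergesToBoundary (fun n : ℕ => h.line n) ζ ↔ q = q.1 • lightVector ζ := by
    rw [convergesToBoundary_iff, eq_smul_lightVector_iff h.right_fst_pos.ne']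
    exact ⟨tendsto_nhds_unique h.tendsto_klein_line, fun hζ => hζ ▸ h.tendsto_klein_line⟩
  simp only [IsGeodesicLine, h.isometry_line, true_and, IsNullFrame.line_neg, hconv]

theorem isNullFrame_lightVector {ξ η : GromovBoundary (Hyperboloid E)} (hne : ξ ≠ η) :
    IsNullFrame ((dist (direction ξ) (direction η))⁻¹ • lightVector ξ)
      ((dist (direction ξ) (direction η))⁻¹ • lightVector η) := by
  have hd : 0 < dist (direction ξ) (direction η) := dist_pos.2 (direction_injective.ne hne)
  have hfst : 0 < (dist (direction ξ) (direction η))⁻¹ * 1 := by positivity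
  refine ⟨hfst, hfst, ?_, ?_, ?_⟩ <;>
    simp only [map_smul, smul_apply, smul_eq_mul, minkowskiForm_lightVector_self, mul_zero]
  rw [minkowskiForm_lightVector]
  field_simp

theorem isTotal_of_dense_span {A : Set (GromovBoundary (Hyperboloid E))} (hA : A.Nontrivial)
    (h : Dense (Submodule.span ℝ (lightVector '' A) : Set (ℝ × E))) : IsTotalBoundarySet A := by
  intro S hclosed hS hline
  refine eq_univ_of_dense_span hS hclosed (h.mono (SetLike.coe_subset_coe.2 ?_))
  rw [Submodule.span_le, Set.image_subset_iff]
  intro η hη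
  obtain ⟨ξ, hξ, hne⟩ := hA.exists_ne η
  have hframe := isNullFrame_lightVector hne
  have hγ : IsGeodesicLine hframe.line ξ η :=
    (isGeodesicLine_line_iff hframe).2 ⟨by simp [lightVector, homogenize],
      by simp [lightVector, homogenize]⟩
  have hmem (r : ℝ) : (hframe.line r).vec ∈ Submodule.span ℝ (vec '' S) :=
    Submodule.subset_span ⟨_, hline _ ξ hξ η hη hγ r, rfl⟩
  exact (Submodule.smul_mem_iff _ (inv_ne_zero (dist_ne_zero.2 (direction_injective.ne hne)))).1
    (hframe.right_mem zero_ne_one (hmem 0) (hmem 1))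

theorem dense_span_of_isTotal {A : Set (GromovBoundary (Hyperboloid E))}
    (h : IsTotalBoundarySet A) : Dense (Submodule.span ℝ (lightVector '' A) : Set (ℝ × E)) := by
  rw [Submodule.dense_iff_topologicalClosure_eq_top]
  set W := (Submodule.span ℝ (lightVector '' A)).topologicalClosure
  have hlight {ζ : GromovBoundary (Hyperboloid E)} (hζ : ζ ∈ A) : lightVector ζ ∈ W :=
    Submodule.le_topologicalClosure _ (Submodule.subset_span ⟨ζ, hζ, rfl⟩)
  have huniv : {x : Hyperboloid E | x.vec ∈ W} = Set.univ := by
    refine h _ ((Submodule.isClosed_topologicalClosure _).preimage continuous_vec)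
      (isTotallyGeodesic_preimage W) ?_
    intro γ ξ hξ η hη hγ r
    obtain ⟨p, q, hframe, rfl⟩ := exists_isNullFrame_of_isometry hγ.1
    obtain ⟨hp, hq⟩ := (isGeodesicLine_line_iff hframe).1 hγ
    exact hframe.vec_line_mem (hp ▸ W.smul_mem _ (hlight hξ)) (hq ▸ W.smul_mem _ (hlight hη)) r
  rw [eq_top_iff, ← span_range_vec, Submodule.span_le, Set.range_subset_iff]
  exact Set.eq_univ_iff_forall.1 huniv

end GromovBoundary

end Total

/-! ### The Hilbert space of a kernel of conditionally negative type -/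

namespace IsCondNegType

variable {Z : Type*} {K : Z → Z → ℝ}

theorem sum_nonpos (hK : IsCondNegType K) {ι : Type*} [Fintype ι] (x : ι → Z) {l : ι → ℝ}
    (hl : ∑ i, l i = 0) : ∑ i, ∑ j, l i * l j * K (x i) (x j) ≤ 0 := by
  have e := (Fintype.equivFin ι).symm
  have h := hK.nonpos _ (x ∘ e) (l ∘ e) ((e.sum_comp l).trans hl)
  rw [← e.sum_comp]
  refine le_of_eq_of_le (Finset.sum_congr rfl fun i _ => ?_) h
  rw [← e.sum_comp]
  rfl

/-- The kernel `(x, y) ↦ ⟨g x, g y⟩` of a map `g` to a Hilbert space with `‖g x - g y‖² = K x y` and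
`g p = 0`. -/
def centeredKernel (K : Z → Z → ℝ) (p x y : Z) : ℝ := (K x p + K y p - K x y) / 2

theorem sum_centeredKernel_nonneg (hK : IsCondNegType K) (p : Z) {ι : Type*} [Fintype ι]
    (x : ι → Z) (l : ι → ℝ) : 0 ≤ ∑ i, ∑ j, l i * l j * centeredKernel K p (x i) (x j) := by
  -- Give the base point `p` the weight that makes the total weight zero.
  have h := hK.sum_nonpos (fun i : Option ι => i.elim p x) (l := fun i => i.elim (-∑ i, l i) l)
    (by simp only [Fintype.sum_option, Option.elim_none, Option.elim_some, neg_add_cancel])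
  simp only [Fintype.sum_option, Option.elim_none, Option.elim_some, hK.diag, hK.symm p, mul_zero,
    zero_add, Finset.sum_add_distrib] at h
  have hcross : ∑ i, l i * -(∑ j, l j) * K (x i) p = -∑ i, ∑ j, l i * l j * K (x i) p := by
    simp only [mul_neg, neg_mul, Finset.sum_neg_distrib, Finset.mul_sum, Finset.sum_mul]
  have hcross' : ∑ j, -(∑ i, l i) * l j * K (x j) p = -∑ i, ∑ j, l i * l j * K (x j) p := by
    rw [Finset.sum_comm]
    simp only [neg_mul, Finset.sum_neg_distrib, Finset.sum_mul]
  have hsplit : ∑ i, ∑ j, l i * l j * centeredKernel K p (x i) (x j) =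
      (∑ i, ∑ j, l i * l j * K (x i) p + ∑ i, ∑ j, l i * l j * K (x j) p -
        ∑ i, ∑ j, l i * l j * K (x i) (x j)) / 2 := by
    simp only [centeredKernel, ← Finset.sum_add_distrib, ← Finset.sum_sub_distrib, Finset.sum_div]
    exact Finset.sum_congr rfl fun i _ => Finset.sum_congr rfl fun j _ => by ring
  linarith

theorem posSemidef_centeredKernel (hK : IsCondNegType K) (p : Z) :
    (Matrix.of fun x y => centeredKernel K p x y • (1 : ℝ →L[ℝ] ℝ)).PosSemidef := by
  have htfae := (RKHS.posSemidef_tfae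
    (K := Matrix.of fun x y => centeredKernel K p x y • (1 : ℝ →L[ℝ] ℝ))).out 0 2
  refine htfae.2 ⟨?_, fun c => ?_⟩
  · ext x y
    simp [Matrix.conjTranspose, centeredKernel, hK.symm x y, add_comm]
  · refine (hK.sum_centeredKernel_nonneg p ((↑) : c.support → Z) fun i => c i).trans_eq ?_
    refine (c.support.sum_coe_sort fun x =>
      ∑ j : c.support, c x * c j * centeredKernel K p x j).trans ?_
    refine Finset.sum_congr rfl fun x _ => ?_
    refine (c.support.sum_coe_sort fun y => c x * c y * centeredKernel K p x y).trans ?_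
    refine Finset.sum_congr rfl fun y _ => ?_
    change _ = inner ℝ (centeredKernel K p y x * c x) (c y)
    rw [Real.inner_apply, centeredKernel, centeredKernel, hK.symm y x]
    ring

theorem exists_hilbert {Z : Type u} {K : Z → Z → ℝ} (hK : IsCondNegType K) (p : Z) :
    ∃ (H : Type u) (_ : NormedAddCommGroup H) (_ : InnerProductSpace ℝ H) (_ : CompleteSpace H)
      (g : Z → H), g p = 0 ∧ (∀ x y, ‖g x - g y‖ ^ 2 = K x y) ∧
        Dense (Submodule.span ℝ (Set.range g) : Set H) := by
  let M := Matrix.of fun x y => centeredKernel K p x y • (1 : ℝ →L[ℝ] ℝ)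
  have : Fact M.PosSemidef := ⟨hK.posSemidef_centeredKernel p⟩
  let g (x : Z) : RKHS.OfKernel M := RKHS.kerFun (RKHS.OfKernel M) x 1
  have hinner (x y : Z) : inner ℝ (g x) (g y) = centeredKernel K p x y := by
    have hkernel := RKHS.kernel_inner (RKHS.OfKernel M) x y 1 1
    rw [RKHS.OfKernel.kernel_ofKernel] at hkernel
    rw [real_inner_comm]
    exact hkernel.symm.trans (by simp [M])
  refine ⟨RKHS.OfKernel M, inferInstance, inferInstance, inferInstance, g, ?_, fun x y => ?_, ?_⟩
  · rw [← inner_self_eq_zero (𝕜 := ℝ), hinner, centeredKernel, hK.diag]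
    norm_num
  · rw [norm_sub_sq_real, ← real_inner_self_eq_norm_sq, ← real_inner_self_eq_norm_sq, hinner,
      hinner, hinner]
    simp only [centeredKernel, hK.diag]
    ring
  · rw [Submodule.dense_iff_topologicalClosure_eq_top, eq_top_iff,
      ← RKHS.kerFun_dense (RKHS.OfKernel M)]
    refine Submodule.topologicalClosure_mono (Submodule.span_le.2 ?_)
    rintro _ ⟨x, r, rfl⟩
    have hsmul : RKHS.kerFun (RKHS.OfKernel M) x r = r • g x := by
      rw [← map_smul, smul_eq_mul, mul_one]
    exact hsmul ▸ Submodule.smul_mem _ _ (Submodule.subset_span ⟨x, rfl⟩)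

end IsCondNegType

theorem exists_linearIsometryEquiv_lp (E : Type u) [NormedAddCommGroup E] [InnerProductSpace ℝ E]
    [CompleteSpace E] :
    ∃ κ : Cardinal.{u}, Nonempty (E ≃ₗᵢ[ℝ] lp (fun _ : κ.out => ℝ) 2) := by
  obtain ⟨w, b, -⟩ := exists_hilbertBasis ℝ E
  let e : (Cardinal.mk w).out ≃ w := Cardinal.outMkEquiv
  have hdense : ⊤ ≤ (Submodule.span ℝ (Set.range (b ∘ e))).topologicalClosure := by
    rw [e.surjective.range_comp, b.dense_span]
  exact ⟨Cardinal.mk w, ⟨(HilbertBasis.mk (b.orthonormal.comp e e.injective) hdense).repr⟩⟩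

/-! ### The horospherical model -/

section Horospherical

variable {H : Type*} [NormedAddCommGroup H] [InnerProductSpace ℝ H]

/-- The isotropic vector of the Minkowski space over `H ⊕ ℝ` which represents the point `z` of the
boundary `H ∪ {∞}` of the upper half-space over `H`. -/
def horoVector (z : H) : ℝ × WithLp 2 (H × ℝ) :=
  (‖z‖ ^ 2 + 1, WithLp.toLp 2 ((2 : ℝ) • z, ‖z‖ ^ 2 - 1))

variable (H) in
/-- The isotropic vector which represents the point `∞` of the boundary `H ∪ {∞}` of the upper
half-space over `H`. -/
def horoInfinity : ℝ × WithLp 2 (H × ℝ) := (1, WithLp.toLp 2 (0, 1))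

theorem minkowskiForm_horoVector (x y : H) :
    ⟪horoVector x, horoVector y⟫ₘ = 2 * ‖x - y‖ ^ 2 := by
  rw [minkowskiForm_apply, norm_sub_sq_real]
  simp only [horoVector, WithLp.prod_inner_apply, real_inner_smul_left, real_inner_smul_right,
    Real.inner_apply]
  ring

theorem minkowskiForm_horoVector_horoInfinity (x : H) : ⟪horoVector x, horoInfinity H⟫ₘ = 2 := by
  rw [minkowskiForm_apply]
  simp only [horoVector, horoInfinity, WithLp.prod_inner_apply, inner_zero_right, Real.inner_apply]
  ring

theorem minkowskiForm_horoInfinity_self : ⟪horoInfinity H, horoInfinity H⟫ₘ = 0 := by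
  rw [minkowskiForm_apply]
  simp only [horoInfinity, WithLp.prod_inner_apply, inner_zero_right, Real.inner_apply]
  ring

theorem dense_span_insert_horoInfinity {s : Set H} (hzero : (0 : H) ∈ s)
    (hs : Dense (Submodule.span ℝ s : Set H)) :
    Dense (Submodule.span ℝ (insert (horoInfinity H) (horoVector '' s)) :
      Set (ℝ × WithLp 2 (H × ℝ))) := by
  set W := Submodule.span ℝ (insert (horoInfinity H) (horoVector '' s))
  have hinfty : horoInfinity H ∈ W := Submodule.subset_span (Set.mem_insert _ _)
  have hmem {z : H} (hz : z ∈ s) : horoVector z ∈ W :=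
    Submodule.subset_span (Set.mem_insert_of_mem _ ⟨z, hz, rfl⟩)
  let ι : H →ₗ[ℝ] ℝ × WithLp 2 (H × ℝ) := LinearMap.inr ℝ ℝ (WithLp 2 (H × ℝ)) ∘ₗ
    (WithLp.linearEquiv 2 ℝ (H × ℝ)).symm.toLinearMap ∘ₗ LinearMap.inl ℝ H ℝ
  have hι (z : H) : ι z = (0, WithLp.toLp 2 (z, 0)) := rfl
  have hιW : Submodule.span ℝ s ≤ W.comap ι := by
    refine Submodule.span_le.2 fun z hz => ?_
    have hcomb : ι z = (2⁻¹ : ℝ) • (horoVector z - horoVector 0 - ‖z‖ ^ 2 • horoInfinity H) := by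
      refine Prod.ext ?_ (WithLp.ofLp_injective 2 (Prod.ext ?_ ?_)) <;>
        simp [hι, horoVector, horoInfinity]
    change ι z ∈ W
    rw [hcomb]
    exact W.smul_mem _ (W.sub_mem (W.sub_mem (hmem hz) (hmem hzero)) (W.smul_mem _ hinfty))
  let T (x : ℝ × ℝ × H) : ℝ × WithLp 2 (H × ℝ) :=
    x.1 • horoInfinity H + x.2.1 • horoVector 0 + ι x.2.2
  have hT : Continuous T := by
    simp only [T, hι]
    fun_prop
  have hsurj : Function.Surjective T := fun v =>
    ⟨((v.1 + v.2.snd) / 2, (v.1 - v.2.snd) / 2, v.2.fst), by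
      refine Prod.ext ?_ (WithLp.ofLp_injective 2 (Prod.ext ?_ ?_)) <;>
        simp [T, hι, horoVector, horoInfinity] <;> ring⟩
  refine (hsurj.denseRange.dense_image hT (dense_univ.prod (dense_univ.prod hs))).mono ?_
  rintro _ ⟨x, ⟨-, -, hx⟩, rfl⟩
  exact W.add_mem (W.add_mem (W.smul_mem _ hinfty) (W.smul_mem _ (hmem hzero))) (hιW hx)

end Horospherical

/-! ### Cross-ratios as quotients of weights -/

section Weight

variable {Y : Type*} {R : Y → Y → Y → Y → ℝ≥0∞} {p q w x y : Y}

open Classical in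
/-- The weight `δ` on pairs of points of `Y` whose cross-ratio is `R`, normalized by `δ x w = 1` for
`x ≠ w`: on `Y \ {w}` it is the square root of `crossRatioKernel`. -/
def crossRatioWeight (R : Y → Y → Y → Y → ℝ≥0∞) (p q w x y : Y) : ℝ≥0∞ :=
  if x = y then 0 else if x = w ∨ y = w then 1
  else if y = p then R x p q w else R x y p w * R y p q w

theorem crossRatioWeight_self (x : Y) : crossRatioWeight R p q w x x = 0 := if_pos rfl

theorem crossRatioWeight_right (hx : x ≠ w) : crossRatioWeight R p q w x w = 1 := by
  simp [crossRatioWeight, hx]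

theorem crossRatioWeight_left (hx : x ≠ w) : crossRatioWeight R p q w w x = 1 := by
  simp [crossRatioWeight, hx.symm]

theorem crossRatioWeight_base (hx : x ≠ w) (hp : p ≠ w) (hxp : x ≠ p) :
    crossRatioWeight R p q w x p = R x p q w := by
  simp [crossRatioWeight, hx, hp, hxp]

theorem crossRatioWeight_of_ne (hx : x ≠ w) (hy : y ≠ w) (hxy : x ≠ y) (hyp : y ≠ p) :
    crossRatioWeight R p q w x y = R x y p w * R y p q w := by
  simp [crossRatioWeight, hx, hy, hxy, hyp]

theorem crossRatioKernel_eq (x y : {y : Y // y ≠ w}) :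
    crossRatioKernel R p q w x y = (crossRatioWeight R p q w x y).toReal ^ 2 := by
  by_cases hxy : x = y
  · simp [crossRatioKernel, hxy, crossRatioWeight_self]
  · simp only [crossRatioKernel, crossRatioWeight, hxy, mt Subtype.ext hxy, x.2, y.2, or_self,
      if_false]
    split_ifs <;> rfl

end Weight

theorem eq_one_of_eq_inv {x : ℝ≥0∞} (h : x = x⁻¹) : x = 1 := by
  rcases le_total x 1 with hx | hx
  · exact hx.antisymm (h ▸ ENNReal.one_le_inv.2 hx)
  · exact (h ▸ ENNReal.inv_le_one.2 hx : x ≤ 1).antisymm hx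

namespace IsAbstractCrossRatio

variable {Y : Type*} [TopologicalSpace Y] {R : Y → Y → Y → Y → ℝ≥0∞} {a b c d p q w : Y}

theorem ne_zero (hR : IsAbstractCrossRatio R) (h : AtLeastThreeDistinct a b c d) (hab : a ≠ b)
    (hcd : c ≠ d) : R a b c d ≠ 0 :=
  mt (hR.eq_zero_iff _ _ _ _ h).1 (not_or.2 ⟨hab, hcd⟩)

theorem ne_top (hR : IsAbstractCrossRatio R) (h : AtLeastThreeDistinct a b c d) (had : a ≠ d)
    (hcb : c ≠ b) : R a b c d ≠ ∞ :=
  mt (hR.eq_top_iff _ _ _ _ h).1 (not_or.2 ⟨had, hcb⟩)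

theorem weight_ne_top (hR : IsAbstractCrossRatio R) (hpq : p ≠ q) (hpw : p ≠ w) (hqw : q ≠ w)
    (x y : Y) : crossRatioWeight R p q w x y ≠ ∞ := by
  unfold crossRatioWeight
  split_ifs with hxy hw hp
  · exact ENNReal.zero_ne_top
  · exact ENNReal.one_ne_top
  · exact hR.ne_top (by grind [AtLeastThreeDistinct]) (by tauto) hpq.symm
  · exact ENNReal.mul_ne_top
      (hR.ne_top (by grind [AtLeastThreeDistinct]) (by tauto) (Ne.symm hp))
      (hR.ne_top (by grind [AtLeastThreeDistinct]) (by tauto) hpq.symm)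

theorem weight_ne_zero (hR : IsAbstractCrossRatio R) (hpq : p ≠ q) (hpw : p ≠ w) (hqw : q ≠ w)
    {x y : Y} (hxy : x ≠ y) : crossRatioWeight R p q w x y ≠ 0 := by
  unfold crossRatioWeight
  rw [if_neg hxy]
  split_ifs with hw hp
  · exact one_ne_zero
  · exact hR.ne_zero (by grind [AtLeastThreeDistinct]) (hp ▸ hxy) hqw
  · exact mul_ne_zero (hR.ne_zero (by grind [AtLeastThreeDistinct]) hxy hpw)
      (hR.ne_zero (by grind [AtLeastThreeDistinct]) hp hqw)

theorem eq_mul_inv_of_ne (hR : IsAbstractCrossRatio R) {x : Y} (hab : a ≠ b) (haw : a ≠ w)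
    (hbw : b ≠ w) (hxb : x ≠ b) (hxw : x ≠ w) :
    R a b c w = R a b x w * (R c b x w)⁻¹ := by
  have hx : AtLeastThreeDistinct a b x w := .inr (.inl ⟨hab, haw, hbw⟩)
  have hxc : AtLeastThreeDistinct x b c w := .inr (.inl ⟨hxb, hxw, hbw⟩)
  rw [hR.cocycle a b c w x (.inr (.inl ⟨hab, haw, hbw⟩)) hx hxc (.inl (hR.ne_zero hx hab hxw))
    (.inl (hR.ne_top hx haw hxb)), hR.inversion_left x b c w hxc]

theorem eq_weight_div_weight (hR : IsAbstractCrossRatio R) (hpq : p ≠ q) (hpw : p ≠ w)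
    (hqw : q ≠ w) (haw : a ≠ w) (hbw : b ≠ w) (hcw : c ≠ w) (hab : a ≠ b) (hcb : c ≠ b) :
    R a b c w = crossRatioWeight R p q w a b / crossRatioWeight R p q w c b := by
  by_cases hbp : b = p
  · rw [hbp] at hab hcb ⊢
    rw [crossRatioWeight_base haw hpw hab, crossRatioWeight_base hcw hpw hcb, div_eq_mul_inv,
      hR.eq_mul_inv_of_ne hab haw hpw hpq.symm hqw]
  · have hq : AtLeastThreeDistinct b p q w := .inr (.inr (.inr ⟨hpq, hpw, hqw⟩))
    rw [crossRatioWeight_of_ne haw hbw hab hbp, crossRatioWeight_of_ne hcw hbw hcb hbp,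
      ENNReal.mul_div_mul_right _ _ (hR.ne_zero hq hbp hqw) (hR.ne_top hq hbw hpq.symm),
      div_eq_mul_inv, hR.eq_mul_inv_of_ne hab haw hbw (Ne.symm hbp) hpw]

theorem eq_crossRatioOf_weight_of_right (hR : IsAbstractCrossRatio R) (hpq : p ≠ q) (hpw : p ≠ w)
    (hqw : q ≠ w) (h : AtLeastThreeDistinct a b c w) (hab : a ≠ b) (haw : a ≠ w) (hcb : c ≠ b)
    (hcw : c ≠ w) : R a b c w = crossRatioOf (crossRatioWeight R p q w) a b c w := by
  rw [crossRatioOf, crossRatioWeight_right haw, crossRatioWeight_right hcw, mul_one, one_mul]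
  by_cases hbw : b = w
  · rw [hbw, crossRatioWeight_right haw, crossRatioWeight_right hcw, ENNReal.div_self one_ne_zero
      ENNReal.one_ne_top]
    exact eq_one_of_eq_inv (hR.inversion_right _ _ _ _ (hbw ▸ h))
  · exact hR.eq_weight_div_weight hpq hpw hqw haw hbw hcw hab hcb

theorem eq_crossRatioOf_weight_of_nondegenerate (hR : IsAbstractCrossRatio R) (hpq : p ≠ q)
    (hpw : p ≠ w) (hqw : q ≠ w)
    (hsymm : ∀ x y, crossRatioWeight R p q w x y = crossRatioWeight R p q w y x)
    (h : AtLeastThreeDistinct a b c d) (hab : a ≠ b) (hcd : c ≠ d) (had : a ≠ d) (hcb : c ≠ b) :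
    R a b c d = crossRatioOf (crossRatioWeight R p q w) a b c d := by
  have hbadc : AtLeastThreeDistinct b a d c := by grind [AtLeastThreeDistinct]
  have hcdab : AtLeastThreeDistinct c d a b := by grind [AtLeastThreeDistinct]
  have hdcba : AtLeastThreeDistinct d c b a := by grind [AtLeastThreeDistinct]
  by_cases hd : d = w
  · subst hd
    exact hR.eq_crossRatioOf_weight_of_right hpq hpw hqw h hab had hcb hcd
  by_cases hb : b = w
  · subst hb
    rw [hR.exchange _ _ _ _ h, hR.eq_crossRatioOf_weight_of_right hpq hpw hqw hcdab hcd hcb had hab]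
    simp only [crossRatioOf, mul_comm]
  by_cases hc : c = w
  · subst hc
    rw [hR.reverse _ _ _ _ h, hR.eq_crossRatioOf_weight_of_right hpq hpw hqw hbadc hab.symm hcb.symm
      had.symm hcd.symm]
    simp only [crossRatioOf, hsymm b a, hsymm d c, hsymm b c, hsymm d a, mul_comm]
  by_cases ha : a = w
  · subst ha
    rw [hR.exchange _ _ _ _ h, hR.reverse _ _ _ _ hcdab,
      hR.eq_crossRatioOf_weight_of_right hpq hpw hqw hdcba hcd.symm had.symm hcb.symm hab.symm]
    simp only [crossRatioOf, hsymm b a, hsymm d c, hsymm b c, hsymm d a, mul_comm]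
  have habwd : AtLeastThreeDistinct a b w d := .inl ⟨hab, ha, hb⟩
  have hwbcd : AtLeastThreeDistinct w b c d := .inl ⟨Ne.symm hb, Ne.symm hc, hcb.symm⟩
  have hcdwb : AtLeastThreeDistinct c d w b := by grind [AtLeastThreeDistinct]
  rw [hR.cocycle a b c d w h habwd hwbcd (.inl (hR.ne_zero habwd hab (Ne.symm hd)))
    (.inl (hR.ne_top habwd had (Ne.symm hb))), hR.reverse _ _ _ _ habwd,
    hR.exchange _ _ _ _ hwbcd, hR.reverse _ _ _ _ hcdwb,
    hR.eq_weight_div_weight hpq hpw hqw hb ha hd hab.symm had.symm,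
    hR.eq_weight_div_weight hpq hpw hqw hd hc hb hcd.symm hcb.symm, crossRatioOf,
    hsymm b a, hsymm d a, hsymm d c, hsymm b c, ENNReal.mul_div_mul_comm]
  · exact .inl (hR.weight_ne_zero hpq hpw hqw had)
  · exact .inl (hR.weight_ne_top hpq hpw hqw a d)

theorem eq_crossRatioOf_weight (hR : IsAbstractCrossRatio R) (hpq : p ≠ q) (hpw : p ≠ w)
    (hqw : q ≠ w) (hsymm : ∀ x y, crossRatioWeight R p q w x y = crossRatioWeight R p q w y x)
    (h : AtLeastThreeDistinct a b c d) :
    R a b c d = crossRatioOf (crossRatioWeight R p q w) a b c d := by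
  by_cases hzero : a = b ∨ c = d
  · rw [(hR.eq_zero_iff _ _ _ _ h).2 hzero]
    rcases hzero with rfl | rfl <;>
      simp only [crossRatioOf, crossRatioWeight_self, zero_mul, mul_zero, ENNReal.zero_div]
  obtain ⟨hab, hcd⟩ := not_or.1 hzero
  by_cases htop : a = d ∨ c = b
  · rw [(hR.eq_top_iff _ _ _ _ h).2 htop, crossRatioOf, eq_comm, ENNReal.div_eq_top]
    refine .inl ⟨mul_ne_zero (hR.weight_ne_zero hpq hpw hqw hab)
      (hR.weight_ne_zero hpq hpw hqw hcd), ?_⟩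
    rcases htop with rfl | rfl <;> simp only [crossRatioWeight_self, zero_mul, mul_zero]
  obtain ⟨had, hcb⟩ := not_or.1 htop
  exact hR.eq_crossRatioOf_weight_of_nondegenerate hpq hpw hqw hsymm h hab hcd had hcb

end IsAbstractCrossRatio

/-! ### Existence -/

theorem three_le_card_iff {α : Type*} :
    3 ≤ ENat.card α ↔ ∃ a b c : α, a ≠ b ∧ a ≠ c ∧ b ≠ c := by
  refine ⟨fun h => ?_, fun ⟨a, b, c, hab, hac, hbc⟩ => ?_⟩
  · obtain ⟨a⟩ := (ENat.one_le_card_iff_nonempty α).1 (le_trans (by norm_num) h)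
    obtain ⟨b, hba, -⟩ := ENat.exists_ne_ne_of_three_le h a a
    obtain ⟨c, hca, hcb⟩ := ENat.exists_ne_ne_of_three_le h a b
    exact ⟨a, b, c, hba.symm, hca.symm, hcb.symm⟩
  · rw [← Set.encard_eq_three.2 ⟨a, b, c, hab, hac, hbc, rfl⟩, ← Set.encard_univ]
    exact Set.encard_le_encard (Set.subset_univ _)

section Existence

open GromovBoundary

section

variable {Y : Type*} [TopologicalSpace Y] {R : Y → Y → Y → Y → ℝ≥0∞}
  {E : Type*} [NormedAddCommGroup E] [InnerProductSpace ℝ E] [CompleteSpace E]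
  {o : Hyperboloid E} {f : Y → GromovBoundary (Hyperboloid E)}

theorem edist_direction_le (ξ η : GromovBoundary (Hyperboloid E)) :
    edist (direction ξ) (direction η) ≤ 2 := by
  refine (edist_triangle _ 0 _).trans_eq ?_
  rw [edist_comm 0, edist_zero_right, edist_zero_right, ← ofReal_norm, ← ofReal_norm,
    norm_direction, norm_direction, ENNReal.ofReal_one, one_add_one_eq_two]

theorem injective_of_crossRatio_eq (hY : 3 ≤ ENat.card Y) (hR : IsAbstractCrossRatio R)
    (hf : ∀ a b c d : Y, AtLeastThreeDistinct a b c d →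
      boundaryCrossRatio o (f a) (f b) (f c) (f d) = R a b c d) : Function.Injective f := by
  intro x y hxy
  by_contra hne
  obtain ⟨c, hcx, hcy⟩ := ENat.exists_ne_ne_of_three_le hY x y
  have hq : AtLeastThreeDistinct x y c y := .inl ⟨hne, hcx.symm, hcy.symm⟩
  refine hR.ne_zero hq hne hcy ?_
  rw [← hf _ _ _ _ hq, boundaryCrossRatio_eq, crossRatioOf, hxy, edist_self, zero_mul,
    ENNReal.zero_div]

theorem continuous_of_crossRatio_eq (hY : 3 ≤ ENat.card Y) (hR : IsAbstractCrossRatio R)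
    (hf : ∀ a b c d : Y, AtLeastThreeDistinct a b c d →
      boundaryCrossRatio o (f a) (f b) (f c) (f d) = R a b c d) : Continuous f := by
  refine continuous_of_continuous_direction (continuous_iff_continuousAt.2 fun y => ?_)
  obtain ⟨a, hay, -⟩ := ENat.exists_ne_ne_of_three_le hY y y
  obtain ⟨b, hby, hba⟩ := ENat.exists_ne_ne_of_three_le hY y a
  have hq (x : Y) : AtLeastThreeDistinct x y a b :=
    .inr (.inr (.inr ⟨hay.symm, hby.symm, hba.symm⟩))
  have hlim : Tendsto (fun x => R x y a b) (𝓝 y) (𝓝 0) := by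
    rw [← (hR.eq_zero_iff y y a b (hq y)).2 (Or.inl rfl)]
    have hmaps : Tendsto (fun x : Y => (x, y, a, b)) (𝓝 y) (𝓝[quadruples Y] (y, y, a, b)) :=
      tendsto_nhdsWithin_iff.2 ⟨(Continuous.prodMk_left (y, a, b)).tendsto y,
        Eventually.of_forall hq⟩
    exact (hR.continuousOn (y, y, a, b) (hq y)).tendsto.comp hmaps
  set e := edist (direction (f a)) (direction (f b))
  have he_ne : e ≠ 0 := fun h =>
    hba.symm (injective_of_crossRatio_eq hY hR hf (direction_injective (edist_eq_zero.1 h)))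
  have hbound (x : Y) : edist (direction (f x)) (direction (f y)) ≤ R x y a b * 4 / e := by
    rw [ENNReal.le_div_iff_mul_le (Or.inl he_ne) (Or.inl (edist_ne_top _ _)),
      ← ENNReal.div_le_iff (by norm_num) (by norm_num), ← hf _ _ _ _ (hq x),
      boundaryCrossRatio_eq, crossRatioOf]
    refine ENNReal.div_le_div_left ((mul_le_mul' (edist_direction_le _ _)
      (edist_direction_le _ _)).trans ?_) _
    norm_num
  refine tendsto_iff_edist_tendsto_0.2 (tendsto_of_tendsto_of_tendsto_of_le_of_le
    tendsto_const_nhds ?_ (fun _ => zero_le) hbound)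
  simpa using ENNReal.Tendsto.div_const
    (ENNReal.Tendsto.mul_const (b := 4) hlim (Or.inr (by norm_num))) (Or.inr he_ne)

end

theorem exists_lightVector_eq {E : Type*} [NormedAddCommGroup E] [InnerProductSpace ℝ E]
    [CompleteSpace E] {v : ℝ × E} (hpos : 0 < v.1) (hv : ⟪v, v⟫ₘ = 0) :
    ∃ ζ : GromovBoundary (Hyperboloid E), v = v.1 • lightVector ζ := by
  rw [minkowskiForm_self, sub_eq_zero] at hv
  have hnorm : ‖v.1⁻¹ • v.2‖ = 1 := by
    rw [norm_smul, norm_inv, Real.norm_of_nonneg hpos.le,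
      ← (pow_left_inj₀ hpos.le (norm_nonneg _) two_ne_zero).1 hv, inv_mul_cancel₀ hpos.ne']
  obtain ⟨ζ, hζ⟩ := exists_direction_eq hnorm
  exact ⟨ζ, (eq_smul_lightVector_iff hpos.ne').2 hζ.symm⟩

theorem boundaryCrossRatio_eq_of_gram {Z E : Type*} [NormedAddCommGroup E] [InnerProductSpace ℝ E]
    [CompleteSpace E] {u : Z → ℝ × E} {f : Z → GromovBoundary (Hyperboloid E)} {δ : Z → Z → ℝ≥0∞}
    (hpos : ∀ z, 0 < (u z).1) (hu : ∀ z, u z = (u z).1 • lightVector (f z))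
    (hδ : ∀ x y, δ x y ≠ ∞) (hgram : ∀ x y, ⟪u x, u y⟫ₘ = 2 * (δ x y).toReal ^ 2)
    (o : Hyperboloid E) (a b c d : Z) :
    boundaryCrossRatio o (f a) (f b) (f c) (f d) = crossRatioOf δ a b c d := by
  let k (z : Z) : ℝ := √(2 / (u z).1)
  have hk (z : Z) : 0 < k z := Real.sqrt_pos.2 (div_pos two_pos (hpos z))
  have hdist (x y : Z) : dist (direction (f x)) (direction (f y)) = (δ x y).toReal * k x * k y := by
    have hx := hpos x
    have hy := hpos y
    have hxy := hgram x y
    rw [hu x, hu y] at hxy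
    simp only [map_smul, smul_apply, smul_eq_mul, minkowskiForm_lightVector] at hxy
    refine (pow_left_inj₀ dist_nonneg (mul_nonneg (mul_nonneg ENNReal.toReal_nonneg (hk x).le)
      (hk y).le) two_ne_zero).1 ?_
    simp only [k, mul_pow]
    rw [Real.sq_sqrt (by positivity), Real.sq_sqrt (by positivity)]
    field_simp
    linear_combination 2 * hxy
  have hedist (x y : Z) : edist (direction (f x)) (direction (f y)) =
      δ x y * ENNReal.ofReal (k x) * ENNReal.ofReal (k y) := by
    rw [edist_dist, hdist, ENNReal.ofReal_mul (mul_nonneg ENNReal.toReal_nonneg (hk x).le),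
      ENNReal.ofReal_mul ENNReal.toReal_nonneg, ENNReal.ofReal_toReal (hδ x y)]
  rw [boundaryCrossRatio_eq]
  exact congr_fun (congr_fun (congr_fun (congr_fun (crossRatioOf_rescale hedist
    (fun z => (ENNReal.ofReal_pos.2 (hk z)).ne') fun z => ENNReal.ofReal_ne_top) a) b) c) d

theorem symm_of_gram {Z E : Type*} [NormedAddCommGroup E] [InnerProductSpace ℝ E]
    {u : Z → ℝ × E} {δ : Z → Z → ℝ≥0∞} (hδ : ∀ x y, δ x y ≠ ∞)
    (hgram : ∀ x y, ⟪u x, u y⟫ₘ = 2 * (δ x y).toReal ^ 2) (x y : Z) : δ x y = δ y x := by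
  have hxy := hgram x y
  rw [minkowskiForm_comm, hgram y x, mul_right_inj' two_ne_zero,
    pow_left_inj₀ ENNReal.toReal_nonneg ENNReal.toReal_nonneg two_ne_zero] at hxy
  exact ((ENNReal.toReal_eq_toReal_iff' (hδ y x) (hδ x y)).1 hxy).symm

theorem dense_span_range_of_eq_smul {Z V : Type*} [AddCommGroup V] [Module ℝ V]
    [TopologicalSpace V] {u v : Z → V} {k : Z → ℝ} (huv : ∀ z, u z = k z • v z)
    (hu : Dense (Submodule.span ℝ (Set.range u) : Set V)) :
    Dense (Submodule.span ℝ (Set.range v) : Set V) := by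
  refine hu.mono (SetLike.coe_subset_coe.2 (Submodule.span_le.2 ?_))
  rintro _ ⟨z, rfl⟩
  exact huv z ▸ Submodule.smul_mem _ _ (Submodule.subset_span ⟨z, rfl⟩)

theorem dense_span_image {V W : Type*} [AddCommGroup V] [Module ℝ V] [TopologicalSpace V]
    [AddCommGroup W] [Module ℝ W] [TopologicalSpace W] {L : V →L[ℝ] W}
    (hL : Function.Surjective L) {s : Set V} (hs : Dense (Submodule.span ℝ s : Set V)) :
    Dense (Submodule.span ℝ (L '' s) : Set W) := by
  have himage : (Submodule.span ℝ (L '' s) : Set W) = L '' Submodule.span ℝ s :=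
    congrArg SetLike.coe (Submodule.map_span (L : V →ₗ[ℝ] W) s).symm
  exact himage ▸ hL.denseRange.dense_image L.continuous hs

theorem minkowskiForm_prodMap {E F : Type*} [NormedAddCommGroup E] [InnerProductSpace ℝ E]
    [NormedAddCommGroup F] [InnerProductSpace ℝ F] (Φ : E →ₗᵢ[ℝ] F) (v w : ℝ × E) :
    ⟪Prod.map id Φ v, Prod.map id Φ w⟫ₘ = ⟪v, w⟫ₘ := by
  simp only [minkowskiForm_apply, Prod.map_fst, Prod.map_snd, id_eq, Φ.inner_map_map]

theorem exists_isotropic_of_isCondNegType {Y : Type u} {R : Y → Y → Y → Y → ℝ≥0∞} {p q w : Y}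
    (hpw : p ≠ w) (hK : IsCondNegType (crossRatioKernel R p q w)) :
    ∃ (H : Type u) (_ : NormedAddCommGroup H) (_ : InnerProductSpace ℝ H) (_ : CompleteSpace H)
      (u : Y → ℝ × H), (∀ y, 0 < (u y).1) ∧
        (∀ x y, ⟪u x, u y⟫ₘ = 2 * (crossRatioWeight R p q w x y).toReal ^ 2) ∧
        Dense (Submodule.span ℝ (Set.range u) : Set (ℝ × H)) := by
  classical
  obtain ⟨H, _, _, _, g, hg_zero, hg, hdense⟩ := hK.exists_hilbert ⟨p, hpw⟩
  let u (y : Y) : ℝ × WithLp 2 (H × ℝ) :=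
    if h : y = w then horoInfinity H else horoVector (g ⟨y, h⟩)
  have hu_base : u w = horoInfinity H := dif_pos rfl
  have hu {y : Y} (h : y ≠ w) : u y = horoVector (g ⟨y, h⟩) := dif_neg h
  refine ⟨WithLp 2 (H × ℝ), inferInstance, inferInstance, inferInstance, u, fun y => ?_,
    fun x y => ?_, ?_⟩
  · by_cases hy : y = w
    · exact hy ▸ hu_base ▸ one_pos
    · rw [hu hy]
      exact add_pos_of_nonneg_of_pos (sq_nonneg _) one_pos
  · by_cases hx : x = w <;> by_cases hy : y = w
    · rw [hx, hy, hu_base, minkowskiForm_horoInfinity_self, crossRatioWeight_self]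
      simp
    · rw [hx, hu_base, hu hy, minkowskiForm_comm, minkowskiForm_horoVector_horoInfinity,
        crossRatioWeight_left hy]
      simp
    · rw [hy, hu_base, hu hx, minkowskiForm_horoVector_horoInfinity, crossRatioWeight_right hx]
      simp
    · rw [hu hx, hu hy, minkowskiForm_horoVector, hg, crossRatioKernel_eq]
  · have hsub : insert (horoInfinity H) (horoVector '' Set.range g) ⊆ Set.range u := by
      refine Set.insert_subset ⟨w, hu_base⟩ ?_
      rintro _ ⟨_, ⟨y, rfl⟩, rfl⟩
      exact ⟨y, hu y.2⟩
    exact (dense_span_insert_horoInfinity (s := Set.range g) ⟨⟨p, hpw⟩, hg_zero⟩ hdense).mono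
      (Submodule.span_mono hsub)

theorem exists_lp_family {Y : Type*} {H : Type u} [NormedAddCommGroup H] [InnerProductSpace ℝ H]
    [CompleteSpace H] {u : Y → ℝ × H}
    (hu : Dense (Submodule.span ℝ (Set.range u) : Set (ℝ × H))) :
    ∃ (κ : Cardinal.{u}) (v : Y → ℝ × lp (fun _ : κ.out => ℝ) 2),
      (∀ y, (v y).1 = (u y).1) ∧ (∀ x y, ⟪v x, v y⟫ₘ = ⟪u x, u y⟫ₘ) ∧
        Dense (Submodule.span ℝ (Set.range v) : Set (ℝ × lp (fun _ : κ.out => ℝ) 2)) := by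
  obtain ⟨κ, ⟨Φ⟩⟩ := exists_linearIsometryEquiv_lp H
  let L : (ℝ × H) ≃L[ℝ] (ℝ × lp (fun _ : κ.out => ℝ) 2) :=
    (ContinuousLinearEquiv.refl ℝ ℝ).prodCongr Φ.toContinuousLinearEquiv
  exact ⟨κ, L ∘ u, fun _ => rfl, fun _ _ => minkowskiForm_prodMap Φ.toLinearIsometry _ _,
    Set.range_comp L u ▸ dense_span_image (L := L.toContinuousLinearMap) L.surjective hu⟩

theorem exists_realizesCrossRatio {Y : Type u} [TopologicalSpace Y] {R : Y → Y → Y → Y → ℝ≥0∞}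
    (hR : IsAbstractCrossRatio R) {p q w : Y} (hpq : p ≠ q) (hpw : p ≠ w) (hqw : q ≠ w)
    (hK : IsCondNegType (crossRatioKernel R p q w)) :
    ∃ (κ : Cardinal.{u}) (f : Y → GromovBoundary (AlgHyperbolicSpace κ)),
      RealizesCrossRatio R κ f := by
  obtain ⟨H, _, _, _, u, hpos, hgram, hdense⟩ := exists_isotropic_of_isCondNegType hpw hK
  obtain ⟨κ, v, hv_fst, hv_gram, hv_dense⟩ := exists_lp_family hdense
  simp only [← hv_fst] at hpos
  simp only [← hv_gram] at hgram
  have hself (y : Y) : ⟪v y, v y⟫ₘ = 0 := by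
    rw [hgram, crossRatioWeight_self]
    simp
  choose f hf using fun y => exists_lightVector_eq (hpos y) (hself y)
  have hδ := hR.weight_ne_top hpq hpw hqw
  have hcross (o : AlgHyperbolicSpace κ) (a b c d : Y) (h : AtLeastThreeDistinct a b c d) :
      boundaryCrossRatio o (f a) (f b) (f c) (f d) = R a b c d :=
    (boundaryCrossRatio_eq_of_gram hpos hf hδ hgram o a b c d).trans
      (hR.eq_crossRatioOf_weight hpq hpw hqw (symm_of_gram hδ hgram) h).symm
  have hcard : 3 ≤ ENat.card Y := three_le_card_iff.2 ⟨p, q, w, hpq, hpw, hqw⟩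
  have hinj := injective_of_crossRatio_eq hcard hR (hcross Hyperboloid.origin)
  exact ⟨κ, f, continuous_of_crossRatio_eq hcard hR (hcross Hyperboloid.origin),
    isTotal_of_dense_span ⟨f p, ⟨p, rfl⟩, f q, ⟨q, rfl⟩, hinj.ne hpq⟩
      (Set.range_comp lightVector f ▸ dense_span_range_of_eq_smul hf hv_dense), hcross⟩

end Existence

/-! ### Isometries of Minkowski spaces -/

section MinkowskiIsometry

open Hyperboloid

variable {E : Type*} [NormedAddCommGroup E] [InnerProductSpace ℝ E]
  {F : Type*} [NormedAddCommGroup F] [InnerProductSpace ℝ F]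

/-- The reflection of the Minkowski space which fixes `m` and is `-1` on its orthogonal complement.
For isotropic `m` it takes the junk value `-id`. -/
def pointReflection (m : ℝ × E) : (ℝ × E) →L[ℝ] (ℝ × E) :=
  (2 / ⟪m, m⟫ₘ) • (minkowskiForm m).smulRight m - ContinuousLinearMap.id ℝ _

theorem pointReflection_apply (m v : ℝ × E) :
    pointReflection m v = (2 / ⟪m, m⟫ₘ * ⟪m, v⟫ₘ) • m - v := by
  simp [pointReflection, smul_smul]

theorem minkowskiForm_pointReflection {m : ℝ × E} (hm : ⟪m, m⟫ₘ ≠ 0) (v w : ℝ × E) :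
    ⟪pointReflection m v, pointReflection m w⟫ₘ = ⟪v, w⟫ₘ := by
  simp only [pointReflection_apply, map_sub, map_smul, sub_apply, smul_apply, smul_eq_mul,
    minkowskiForm_comm v m]
  field_simp
  ring

theorem involutive_pointReflection {m : ℝ × E} (hm : ⟪m, m⟫ₘ ≠ 0) :
    Function.Involutive (pointReflection m) := fun v => by
  simp only [pointReflection_apply, map_sub, map_smul, div_mul_cancel₀ (2 : ℝ) hm]
  module

theorem pointReflection_add_left {v w : ℝ × E} (hvw : ⟪v, v⟫ₘ = ⟪w, w⟫ₘ)
    (hm : ⟪v + w, v + w⟫ₘ ≠ 0) : pointReflection (v + w) v = w := by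
  have hcoeff : ⟪v + w, v + w⟫ₘ = 2 * ⟪v + w, v⟫ₘ := by
    simp only [map_add, add_apply, hvw, minkowskiForm_comm w v]
    ring
  rw [pointReflection_apply, div_mul_eq_mul_div, ← hcoeff, div_self hm, one_smul,
    add_sub_cancel_left]

theorem minkowskiForm_vec_origin (v : ℝ × E) : ⟪(origin : Hyperboloid E).vec, v⟫ₘ = v.1 := by
  simp [minkowskiForm_apply, origin, vec]

theorem exists_equiv_apply_eq_origin (z : Hyperboloid E) :
    ∃ s : (ℝ × E) ≃L[ℝ] (ℝ × E), (∀ v w, ⟪s v, s w⟫ₘ = ⟪v, w⟫ₘ) ∧ s z.vec = origin.vec := by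
  have hm : ⟪z.vec + origin.vec, z.vec + origin.vec⟫ₘ ≠ 0 :=
    (add_mem_futureCone z.vec_mem_futureCone origin.vec_mem_futureCone).2.ne'
  have hinv := involutive_pointReflection hm
  exact ⟨ContinuousLinearEquiv.equivOfInverse (pointReflection _) (pointReflection _) hinv hinv,
    minkowskiForm_pointReflection hm,
    pointReflection_add_left (by rw [minkowskiForm_vec_self, minkowskiForm_vec_self]) hm⟩

theorem exists_linearIsometryEquiv_of_inner_eq [CompleteSpace E] [CompleteSpace F] {Y : Type*}
    {u : Y → E} {v : Y → F} (huv : ∀ x y, inner ℝ (u x) (u y) = inner ℝ (v x) (v y))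
    (hu : Dense (Submodule.span ℝ (Set.range u) : Set E))
    (hv : Dense (Submodule.span ℝ (Set.range v) : Set F)) :
    ∃ Φ : E ≃ₗᵢ[ℝ] F, ∀ y, Φ (u y) = v y := by
  let U := Finsupp.linearCombination ℝ u
  let V := Finsupp.linearCombination ℝ v
  have hU : DenseRange U := by
    rwa [DenseRange, ← LinearMap.coe_range, Finsupp.range_linearCombination]
  have hV : DenseRange V := by
    rwa [DenseRange, ← LinearMap.coe_range, Finsupp.range_linearCombination]
  have hnorm (c : Y →₀ ℝ) : ‖V c‖ = ‖U c‖ := by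
    refine (pow_left_inj₀ (norm_nonneg _) (norm_nonneg _) two_ne_zero).1 ?_
    simp only [← real_inner_self_eq_norm_sq, U, V, Finsupp.linearCombination_apply,
      Finsupp.sum, sum_inner, inner_sum, real_inner_smul_left, real_inner_smul_right, huv]
  refine ⟨LinearEquiv.extendOfIsometry (LinearEquiv.refl ℝ _) U V hU hV hnorm, fun y => ?_⟩
  simpa [U, V] using LinearEquiv.extendOfIsometry_eq (LinearEquiv.refl ℝ (Y →₀ ℝ)) U V hU hV hnorm
    (Finsupp.single y 1)

theorem exists_minkowskiEquiv_of_fst_eq [CompleteSpace E] [CompleteSpace F] {Y : Type*}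
    {u : Y → ℝ × E} {v : Y → ℝ × F} (huv : ∀ x y, ⟪u x, u y⟫ₘ = ⟪v x, v y⟫ₘ)
    (hfst : ∀ y, (u y).1 = (v y).1) (hu : Dense (Submodule.span ℝ (Set.range u) : Set (ℝ × E)))
    (hv : Dense (Submodule.span ℝ (Set.range v) : Set (ℝ × F))) :
    ∃ Φ : E ≃ₗᵢ[ℝ] F, ∀ y, Prod.map id Φ (u y) = v y := by
  have hu' := dense_span_image (L := ContinuousLinearMap.snd ℝ ℝ E) Prod.snd_surjective hu
  have hv' := dense_span_image (L := ContinuousLinearMap.snd ℝ ℝ F) Prod.snd_surjective hv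
  rw [← Set.range_comp] at hu' hv'
  have hinner (x y : Y) : inner ℝ (u x).2 (u y).2 = inner ℝ (v x).2 (v y).2 := by
    have hxy := huv x y
    rw [minkowskiForm_apply, minkowskiForm_apply, hfst, hfst] at hxy
    exact sub_right_injective hxy
  obtain ⟨Φ, hΦ⟩ := exists_linearIsometryEquiv_of_inner_eq hinner hu' hv'
  exact ⟨Φ, fun y => Prod.ext (hfst y) (hΦ y)⟩

theorem exists_minkowskiEquiv [CompleteSpace E] [CompleteSpace F] {Y : Type*}
    {u : Y → ℝ × E} {v : Y → ℝ × F} (huv : ∀ x y, ⟪u x, u y⟫ₘ = ⟪v x, v y⟫ₘ)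
    (hu : Dense (Submodule.span ℝ (Set.range u) : Set (ℝ × E)))
    (hv : Dense (Submodule.span ℝ (Set.range v) : Set (ℝ × F)))
    {z : Hyperboloid E} {z' : Hyperboloid F} (hz : ∀ y, ⟪z.vec, u y⟫ₘ = ⟪z'.vec, v y⟫ₘ) :
    Nonempty (E ≃ₗᵢ[ℝ] F) ∧ ∃ T : (ℝ × E) ≃L[ℝ] (ℝ × F), (∀ a b, ⟪T a, T b⟫ₘ = ⟪a, b⟫ₘ) ∧
      (∀ y, T (u y) = v y) ∧ T z.vec = z'.vec := by
  obtain ⟨s, hs, hsz⟩ := exists_equiv_apply_eq_origin z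
  obtain ⟨s', hs', hsz'⟩ := exists_equiv_apply_eq_origin z'
  obtain ⟨Φ, hΦ⟩ := exists_minkowskiEquiv_of_fst_eq (u := s ∘ u) (v := s' ∘ v)
    (fun x y => by simp only [Function.comp_apply, hs, hs', huv])
    (fun y => by
      rw [← minkowskiForm_vec_origin, ← hsz, ← minkowskiForm_vec_origin, ← hsz']
      simp only [Function.comp_apply, hs, hs', hz])
    (Set.range_comp s u ▸ dense_span_image (L := s.toContinuousLinearMap) s.surjective hu)
    (Set.range_comp s' v ▸ dense_span_image (L := s'.toContinuousLinearMap) s'.surjective hv)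
  let L : (ℝ × E) ≃L[ℝ] (ℝ × F) :=
    (ContinuousLinearEquiv.refl ℝ ℝ).prodCongr Φ.toContinuousLinearEquiv
  refine ⟨⟨Φ⟩, (s.trans L).trans s'.symm, fun a b => ?_, fun y => s'.symm_apply_eq.2 (hΦ y),
    s'.symm_apply_eq.2 ?_⟩
  · rw [← hs', ← hs a b]
    exact (congrArg₂ (fun v w => ⟪v, w⟫ₘ) (s'.apply_symm_apply _) (s'.apply_symm_apply _)).trans
      (minkowskiForm_prodMap Φ.toLinearIsometry _ _)
  · rw [hsz']
    exact (congrArg L hsz).trans (Prod.ext rfl Φ.map_zero)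

theorem exists_vec_eq {z : Hyperboloid E} {v : ℝ × E} (hv : ⟪v, v⟫ₘ = 1)
    (hz : 0 < ⟪z.vec, v⟫ₘ) : ∃ x : Hyperboloid E, x.vec = v :=
  ⟨ofVec v (fst_pos_of_minkowskiForm_pos z.vec_mem_futureCone (by simp [hv]) hz) hv, rfl⟩

theorem exists_vec_eq_apply {T : (ℝ × E) → (ℝ × F)} (hT : ∀ a b, ⟪T a, T b⟫ₘ = ⟪a, b⟫ₘ)
    {z : Hyperboloid E} {z' : Hyperboloid F} (hz : T z.vec = z'.vec) (x : Hyperboloid E) :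
    ∃ y : Hyperboloid F, y.vec = T x.vec := by
  refine exists_vec_eq (z := z') (by rw [hT, minkowskiForm_vec_self]) ?_
  rw [← hz, hT, ← form_eq_minkowskiForm]
  exact one_pos.trans_le (one_le_form _ _)

theorem exists_isometryEquiv_vec_eq (T : (ℝ × E) ≃ (ℝ × F)) (hT : ∀ a b, ⟪T a, T b⟫ₘ = ⟪a, b⟫ₘ)
    {z : Hyperboloid E} {z' : Hyperboloid F} (hz : T z.vec = z'.vec) :
    ∃ φ : Hyperboloid E ≃ᵢ Hyperboloid F, ∀ x, (φ x).vec = T x.vec := by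
  have hT_symm (a b : ℝ × F) : ⟪T.symm a, T.symm b⟫ₘ = ⟪a, b⟫ₘ := by
    rw [← hT, T.apply_symm_apply, T.apply_symm_apply]
  choose φ hφ using exists_vec_eq_apply hT hz
  choose ψ hψ using exists_vec_eq_apply hT_symm (T.symm_apply_eq.2 hz.symm)
  refine ⟨IsometryEquiv.mk' φ ψ (fun y => vec_injective ?_) (isometry_iff_form_eq.2 fun x y => ?_),
    hφ⟩
  · rw [hφ, hψ, T.apply_symm_apply]
  · rw [form_eq_minkowskiForm, form_eq_minkowskiForm, hφ, hφ, hT]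

end MinkowskiIsometry

/-! ### Boundary extensions of distance-preserving maps -/

namespace GromovBoundary

theorem boundaryMap_comp {X Y Z : Type*} [MetricSpace X] [MetricSpace Y] [MetricSpace Z]
    {φ : Y → Z} {ψ : X → Y} (hφ : Isometry φ) (hψ : Isometry ψ) (ξ : GromovBoundary X) :
    boundaryMap (φ ∘ ψ) (hφ.comp hψ) ξ = boundaryMap φ hφ (boundaryMap ψ hψ ξ) := by
  induction ξ using Quot.ind
  rfl

theorem boundaryMap_symm_apply {X Y : Type*} [MetricSpace X] [MetricSpace Y] (φ : X ≃ᵢ Y)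
    (ξ : GromovBoundary X) :
    boundaryMap φ.symm φ.symm.isometry (boundaryMap φ φ.isometry ξ) = ξ := by
  induction ξ using Quot.ind with | _ s
  exact congrArg (Quot.mk _) (Subtype.ext (funext fun n => φ.symm_apply_apply (s.1 n)))

open Hyperboloid

variable {E : Type*} [NormedAddCommGroup E] [InnerProductSpace ℝ E] [CompleteSpace E]
  {F : Type*} [NormedAddCommGroup F] [InnerProductSpace ℝ F] [CompleteSpace F]
  {ψ : Hyperboloid E → Hyperboloid F}

theorem boundaryMap_eq_of_map_lightVector {T : (ℝ × E) →L[ℝ] (ℝ × F)} (hψ : Isometry ψ)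
    (hT : ∀ x, (ψ x).vec = T x.vec) {ξ : GromovBoundary (Hyperboloid E)}
    {η : GromovBoundary (Hyperboloid F)} {t : ℝ} (ht : t ≠ 0)
    (h : T (lightVector ξ) = t • lightVector η) : boundaryMap ψ hψ ξ = η := by
  obtain ⟨s, hs⟩ := exists_limit_eq ξ
  have hlim : Tendsto (fun n => (s.1 n).time⁻¹ • (ψ (s.1 n)).vec) atTop
      (𝓝 (t • lightVector η)) := by
    simp only [hT, ← map_smul, ← h]
    exact (T.continuous.tendsto _).comp (tendsto_inv_time_smul_vec (tendsto_klein hs))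
  have hη : (t • lightVector η).1⁻¹ • (t • lightVector η).2 = direction η := by
    simp [lightVector, homogenize, ht]
  have hconv : ConvergesToBoundary (fun n => ψ (s.1 n)) η :=
    convergesToBoundary_iff.2 (hη ▸ tendsto_klein_of_tendsto_smul_vec
      (by simp [lightVector, homogenize, ht]) hlim)
  exact hs ▸ hconv.choose_spec

/-- The dilation factor at the boundary point `ζ` of a distance-preserving map `ψ`, by which `ψ`
rescales the horofunctions `x ↦ ⟪x.vec, lightVector ζ⟫ₘ` centred at `ζ`. The origin is an arbitrary
choice of base point. -/
def boundaryDilation (ψ : Hyperboloid E → Hyperboloid F) (hψ : Isometry ψ)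
    (ζ : GromovBoundary (Hyperboloid E)) : ℝ :=
  ⟪origin.vec, lightVector ζ⟫ₘ / ⟪(ψ origin).vec, lightVector (boundaryMap ψ hψ ζ)⟫ₘ

theorem boundaryDilation_pos (hψ : Isometry ψ) (ζ : GromovBoundary (Hyperboloid E)) :
    0 < boundaryDilation ψ hψ ζ :=
  div_pos (minkowskiForm_lightVector_pos origin.vec_mem_futureCone ζ)
    (minkowskiForm_lightVector_pos (ψ origin).vec_mem_futureCone _)

theorem tendsto_inv_time_smul_vec_map (hψ : Isometry ψ) {s : InfinitySeq (Hyperboloid E)}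
    {ζ : GromovBoundary (Hyperboloid E)} (hs : s.limit = ζ) :
    Tendsto (fun n => (s.1 n).time⁻¹ • (ψ (s.1 n)).vec) atTop
      (𝓝 (boundaryDilation ψ hψ ζ • lightVector (boundaryMap ψ hψ ζ))) := by
  have hs_lim : Tendsto (fun n => (s.1 n).time⁻¹ • (s.1 n).vec) atTop (𝓝 (lightVector ζ)) :=
    tendsto_inv_time_smul_vec (tendsto_klein hs)
  have hmap : (s.map ψ hψ).limit = boundaryMap ψ hψ ζ := hs ▸ rfl
  have hψs : Tendsto (fun n => (ψ (s.1 n)).time⁻¹ • (ψ (s.1 n)).vec) atTop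
      (𝓝 (lightVector (boundaryMap ψ hψ ζ))) :=
    tendsto_inv_time_smul_vec (tendsto_klein hmap)
  have hratio := (tendsto_minkowskiForm (tendsto_const_nhds (x := origin.vec)) hs_lim).div
    (tendsto_minkowskiForm (tendsto_const_nhds (x := (ψ origin).vec)) hψs)
    (minkowskiForm_lightVector_pos (ψ origin).vec_mem_futureCone _).ne'
  refine (hratio.smul hψs).congr fun n => ?_
  have hpos : 0 < form origin (s.1 n) := one_pos.trans_le (one_le_form _ _)
  simp only [Pi.div_apply, map_smul, smul_eq_mul, ← form_eq_minkowskiForm,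
    isometry_iff_form_eq.1 hψ, smul_smul]
  have htime := (s.1 n).time_pos
  have htime' := (ψ (s.1 n)).time_pos
  congr 1
  field_simp

theorem minkowskiForm_vec_lightVector_boundaryMap (hψ : Isometry ψ) (x : Hyperboloid E)
    (ζ : GromovBoundary (Hyperboloid E)) :
    ⟪x.vec, lightVector ζ⟫ₘ =
      boundaryDilation ψ hψ ζ * ⟪(ψ x).vec, lightVector (boundaryMap ψ hψ ζ)⟫ₘ := by
  obtain ⟨s, hs⟩ := exists_limit_eq ζ
  have hlim := tendsto_minkowskiForm (tendsto_const_nhds (x := x.vec))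
    (tendsto_inv_time_smul_vec (tendsto_klein hs))
  have hlim' := tendsto_minkowskiForm (tendsto_const_nhds (x := (ψ x).vec))
    (tendsto_inv_time_smul_vec_map hψ hs)
  simp only [map_smul, smul_eq_mul, ← form_eq_minkowskiForm, isometry_iff_form_eq.1 hψ]
    at hlim hlim'
  exact tendsto_nhds_unique hlim hlim'

theorem minkowskiForm_lightVector_boundaryMap (hψ : Isometry ψ)
    (ξ η : GromovBoundary (Hyperboloid E)) :
    ⟪lightVector ξ, lightVector η⟫ₘ = boundaryDilation ψ hψ ξ * boundaryDilation ψ hψ η *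
      ⟪lightVector (boundaryMap ψ hψ ξ), lightVector (boundaryMap ψ hψ η)⟫ₘ := by
  obtain ⟨s, hs⟩ := exists_limit_eq ξ
  have hlim := tendsto_minkowskiForm (tendsto_inv_time_smul_vec (tendsto_klein hs))
    (tendsto_const_nhds (x := lightVector η))
  have hlim' := (tendsto_minkowskiForm (tendsto_inv_time_smul_vec_map hψ hs)
    (tendsto_const_nhds (x := lightVector (boundaryMap ψ hψ η)))).const_mul
      (boundaryDilation ψ hψ η)
  simp only [map_smul, smul_apply, smul_eq_mul,
    minkowskiForm_vec_lightVector_boundaryMap hψ _ η] at hlim hlim'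
  refine (tendsto_nhds_unique (hlim.congr fun n => mul_left_comm _ _ _) hlim').trans ?_
  ring

theorem minkowskiForm_lightVector_pos_of_ne {ξ η : GromovBoundary (Hyperboloid E)} (h : ξ ≠ η) :
    0 < ⟪lightVector ξ, lightVector η⟫ₘ := by
  have hdist := dist_pos.2 (direction_injective.ne h)
  rw [minkowskiForm_lightVector]
  positivity

theorem boundaryDilation_eq_one {A : Set (GromovBoundary (Hyperboloid E))} (hA : 3 ≤ A.encard)
    {χ : Hyperboloid E → Hyperboloid E} (hχ : Isometry χ)
    (hfix : ∀ ξ ∈ A, boundaryMap χ hχ ξ = ξ) {ξ : GromovBoundary (Hyperboloid E)} (hξ : ξ ∈ A) :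
    boundaryDilation χ hχ ξ = 1 := by
  have hmul (ξ η : A) (h : ξ ≠ η) : boundaryDilation χ hχ ξ * boundaryDilation χ hχ η = 1 := by
    have hform := minkowskiForm_lightVector_boundaryMap hχ (ξ : GromovBoundary _) η
    rw [hfix _ ξ.2, hfix _ η.2] at hform
    exact (mul_eq_right₀ (minkowskiForm_lightVector_pos_of_ne (Subtype.coe_ne_coe.2 h)).ne').1
      hform.symm
  obtain ⟨η, hη, -⟩ := ENat.exists_ne_ne_of_three_le hA (⟨ξ, hξ⟩ : A) ⟨ξ, hξ⟩
  obtain ⟨ζ, hζξ, hζη⟩ := ENat.exists_ne_ne_of_three_le hA (⟨ξ, hξ⟩ : A) η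
  have h₁ := hmul _ _ hη.symm
  have h₂ := hmul _ _ hζξ.symm
  have h₃ := hmul _ _ hζη.symm
  refine (pow_eq_one_iff_of_nonneg (boundaryDilation_pos hχ ξ).le two_ne_zero).1 ?_
  linear_combination (boundaryDilation χ hχ ξ * boundaryDilation χ hχ ζ) * h₁ + h₂ -
    boundaryDilation χ hχ ξ ^ 2 * h₃

theorem eq_self_of_boundaryMap_eq_self {A : Set (GromovBoundary (Hyperboloid E))}
    (hA : 3 ≤ A.encard) (hdense : Dense (Submodule.span ℝ (lightVector '' A) : Set (ℝ × E)))
    {χ : Hyperboloid E → Hyperboloid E} (hχ : Isometry χ)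
    (hfix : ∀ ξ ∈ A, boundaryMap χ hχ ξ = ξ) (x : Hyperboloid E) : χ x = x := by
  refine vec_injective (eq_of_minkowskiForm_eqOn hdense ?_)
  rintro _ ⟨ξ, hξ, rfl⟩
  rw [minkowskiForm_vec_lightVector_boundaryMap hχ x, boundaryDilation_eq_one hA hχ hfix hξ,
    hfix ξ hξ, one_mul]

theorem eq_of_boundaryMap_eqOn {G : Type*} [NormedAddCommGroup G] [InnerProductSpace ℝ G]
    {A : Set (GromovBoundary (Hyperboloid E))} (hA : 3 ≤ A.encard)
    (hdense : Dense (Submodule.span ℝ (lightVector '' A) : Set (ℝ × E)))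
    {ψ : Hyperboloid E → Hyperboloid G} (hψ : Isometry ψ) (φ : Hyperboloid E ≃ᵢ Hyperboloid G)
    (h : Set.EqOn (boundaryMap ψ hψ) (boundaryMap φ φ.isometry) A) : ψ = φ := by
  refine funext fun x => φ.symm_apply_eq.1 (eq_self_of_boundaryMap_eq_self hA hdense
    (φ.symm.isometry.comp hψ) (fun ξ hξ => ?_) x)
  rw [boundaryMap_comp φ.symm.isometry hψ, h hξ, boundaryMap_symm_apply]

end GromovBoundary

/-! ### Realizations with the same cross-ratio -/

section FourCycle

variable {Y : Type*} {ρ : Y → Y → ℝ} {p q w : Y}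

theorem mul_mul_eq_of_four_cycle (hsymm : ∀ x y, ρ x y = ρ y x)
    (h : ∀ a b c d, AtLeastThreeDistinct a b c d → a ≠ b → c ≠ d → a ≠ d → c ≠ b →
      ρ a b * ρ c d = ρ a d * ρ c b) (hpq : p ≠ q) (hpw : p ≠ w) (hqw : q ≠ w) {x y : Y}
    (hxy : x ≠ y) (hx : x ≠ p) (hy : y ≠ p) :
    ρ x y * (ρ p q * ρ p w) = ρ x p * ρ y p * ρ q w := by
  rw [hsymm x p, hsymm y p]
  by_cases hxq : x = q
  · subst hxq
    have hcycle := h x y p w (.inr (.inr (.inl ⟨hx, hqw, hpw⟩))) hxy hpw hqw hy.symm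
    linear_combination ρ p x * hcycle
  · have hcycle_q := h x y p q (.inl ⟨hxy, hx, hy⟩) hxy hpq hxq hy.symm
    have hcycle_w := h q x p w (.inr (.inr (.inl ⟨hpq.symm, hqw, hpw⟩))) (Ne.symm hxq) hpw hqw
      hx.symm
    rw [hsymm q x] at hcycle_w
    linear_combination ρ p w * hcycle_q + ρ p y * hcycle_w

theorem exists_eq_mul_of_four_cycle (hsymm : ∀ x y, ρ x y = ρ y x)
    (hpos : ∀ x y, x ≠ y → 0 < ρ x y)
    (h : ∀ a b c d, AtLeastThreeDistinct a b c d → a ≠ b → c ≠ d → a ≠ d → c ≠ b →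
      ρ a b * ρ c d = ρ a d * ρ c b) (hpq : p ≠ q) (hpw : p ≠ w) (hqw : q ≠ w) :
    ∃ μ : Y → ℝ, (∀ y, 0 < μ y) ∧ ∀ x y, x ≠ y → ρ x y = μ x * μ y := by
  classical
  have hpq_pos := hpos _ _ hpq
  have hpw_pos := hpos _ _ hpw
  have hqw_pos := hpos _ _ hqw
  -- The formula `μ p ^ 2 = (μ p * μ q) * (μ p * μ w) / (μ q * μ w)` forces the value at `p`.
  obtain ⟨m, hm, hm_sq⟩ : ∃ m : ℝ, 0 < m ∧ m ^ 2 * ρ q w = ρ p q * ρ p w :=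
    ⟨√(ρ p q * ρ p w / ρ q w), by positivity, by
      rw [Real.sq_sqrt (by positivity), div_mul_cancel₀ _ hqw_pos.ne']⟩
  let μ : Y → ℝ := fun y => if y = p then m else ρ y p / m
  have hμp : μ p = m := if_pos rfl
  have hμ {y : Y} (hy : y ≠ p) : μ y = ρ y p / m := if_neg hy
  have hbase {y : Y} (hy : y ≠ p) : ρ y p = μ y * μ p := by
    rw [hμp, hμ hy, div_mul_cancel₀ _ hm.ne']
  refine ⟨μ, fun y => ?_, fun x y hxy => ?_⟩
  · rcases eq_or_ne y p with rfl | hy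
    · exact hμp ▸ hm
    · exact hμ hy ▸ div_pos (hpos _ _ hy) hm
  · rcases eq_or_ne x p with rfl | hx
    · rw [hsymm, hbase hxy.symm, mul_comm]
    rcases eq_or_ne y p with rfl | hy
    · exact hbase hx
    rw [hμ hx, hμ hy, div_mul_div_comm, eq_div_iff (by positivity)]
    refine mul_right_cancel₀ hqw_pos.ne' ?_
    linear_combination mul_mul_eq_of_four_cycle hsymm h hpq hpw hqw hxy hx hy + ρ x y * hm_sq

end FourCycle

section Comparison

open GromovBoundary Hyperboloid

variable {E : Type*} [NormedAddCommGroup E] [InnerProductSpace ℝ E] [CompleteSpace E]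
  {F : Type*} [NormedAddCommGroup F] [InnerProductSpace ℝ F] [CompleteSpace F]
  {o : Hyperboloid E} {o' : Hyperboloid F}

theorem dist_direction_mul_eq_of_crossRatio_eq {a b c d : GromovBoundary (Hyperboloid E)}
    {a' b' c' d' : GromovBoundary (Hyperboloid F)}
    (h : boundaryCrossRatio o a b c d = boundaryCrossRatio o' a' b' c' d') (had : a ≠ d)
    (hcb : c ≠ b) (had' : a' ≠ d') (hcb' : c' ≠ b') :
    dist (direction a) (direction b) * dist (direction c) (direction d) *
        (dist (direction a') (direction d') * dist (direction c') (direction b')) =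
      dist (direction a') (direction b') * dist (direction c') (direction d') *
        (dist (direction a) (direction d) * dist (direction c) (direction b)) := by
  have hreal := congrArg ENNReal.toReal h
  simp only [boundaryCrossRatio_eq, crossRatioOf, ENNReal.toReal_div, ENNReal.toReal_mul,
    edist_dist, ENNReal.toReal_ofReal dist_nonneg] at hreal
  have hdist {ξ η : GromovBoundary (Hyperboloid E)} (hξη : ξ ≠ η) :
      dist (direction ξ) (direction η) ≠ 0 := dist_ne_zero.2 (direction_injective.ne hξη)
  have hdist' {ξ η : GromovBoundary (Hyperboloid F)} (hξη : ξ ≠ η) :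
      dist (direction ξ) (direction η) ≠ 0 := dist_ne_zero.2 (direction_injective.ne hξη)
  exact (div_eq_div_iff (mul_ne_zero (hdist had) (hdist hcb))
    (mul_ne_zero (hdist' had') (hdist' hcb'))).1 hreal

variable {Y : Type*} {f : Y → GromovBoundary (Hyperboloid E)}
  {f' : Y → GromovBoundary (Hyperboloid F)}

theorem exists_lightVector_scaling (hY : 3 ≤ ENat.card Y) (hf : Function.Injective f)
    (hf' : Function.Injective f') (h : ∀ a b c d, AtLeastThreeDistinct a b c d →
      boundaryCrossRatio o (f a) (f b) (f c) (f d) =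
        boundaryCrossRatio o' (f' a) (f' b) (f' c) (f' d)) :
    ∃ l : Y → ℝ, (∀ y, 0 < l y) ∧ ∀ x y, ⟪lightVector (f' x), lightVector (f' y)⟫ₘ =
      ⟪l x • lightVector (f x), l y • lightVector (f y)⟫ₘ := by
  have hdist {x y : Y} (hxy : x ≠ y) : 0 < dist (direction (f x)) (direction (f y)) :=
    dist_pos.2 (direction_injective.ne (hf.ne hxy))
  have hdist' {x y : Y} (hxy : x ≠ y) : 0 < dist (direction (f' x)) (direction (f' y)) :=
    dist_pos.2 (direction_injective.ne (hf'.ne hxy))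
  obtain ⟨p, q, w, hpq, hpw, hqw⟩ := three_le_card_iff.1 hY
  obtain ⟨μ, hμ, hμ_mul⟩ := exists_eq_mul_of_four_cycle
    (ρ := fun x y => dist (direction (f' x)) (direction (f' y)) /
      dist (direction (f x)) (direction (f y)))
    (fun x y => by simp only [dist_comm]) (fun x y hxy => div_pos (hdist' hxy) (hdist hxy))
    (fun a b c d hq hab hcd had hcb => by
      rw [div_mul_div_comm, div_mul_div_comm,
        div_eq_div_iff (mul_pos (hdist hab) (hdist hcd)).ne' (mul_pos (hdist had) (hdist hcb)).ne']
      rw [← dist_direction_mul_eq_of_crossRatio_eq (h a b c d hq) (hf.ne had) (hf.ne hcb)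
        (hf'.ne had) (hf'.ne hcb), mul_comm]) hpq hpw hqw
  refine ⟨fun y => μ y ^ 2, fun y => pow_pos (hμ y) 2, fun x y => ?_⟩
  simp only [map_smul, smul_apply, smul_eq_mul]
  rcases eq_or_ne x y with rfl | hxy
  · rw [minkowskiForm_lightVector_self, minkowskiForm_lightVector_self, mul_zero, mul_zero]
  · rw [minkowskiForm_lightVector, minkowskiForm_lightVector,
      (div_eq_iff (hdist hxy).ne').1 (hμ_mul x y hxy)]
    ring

theorem lightVector_add_mem_futureCone {s t : ℝ} (hs : 0 < s) (ht : 0 < t)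
    {ξ η : GromovBoundary (Hyperboloid E)} (hξη : ξ ≠ η) :
    s • lightVector ξ + t • lightVector η ∈ futureCone E := by
  refine ⟨by simp [lightVector, homogenize, add_pos hs ht], ?_⟩
  have hform := minkowskiForm_lightVector_pos_of_ne hξη
  simp only [map_add, add_apply, map_smul, smul_apply, smul_eq_mul, minkowskiForm_lightVector_self,
    minkowskiForm_comm (lightVector η) (lightVector ξ)]
  ring_nf
  positivity

theorem exists_isometryEquiv_of_lightVector_scaling (hf : Function.Injective f)
    (hf' : Function.Injective f') [Nontrivial Y]
    (hdense : Dense (Submodule.span ℝ (Set.range fun y => lightVector (f y)) : Set (ℝ × E)))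
    (hdense' : Dense (Submodule.span ℝ (Set.range fun y => lightVector (f' y)) : Set (ℝ × F)))
    {l : Y → ℝ} (hl : ∀ y, 0 < l y)
    (h : ∀ x y, ⟪lightVector (f' x), lightVector (f' y)⟫ₘ =
      ⟪l x • lightVector (f x), l y • lightVector (f y)⟫ₘ) :
    Nonempty (E ≃ₗᵢ[ℝ] F) ∧ ∃ φ : Hyperboloid E ≃ᵢ Hyperboloid F,
      ∀ y, f' y = boundaryMap φ φ.isometry (f y) := by
  let u : Y → ℝ × E := fun y => l y • lightVector (f y)
  let v : Y → ℝ × F := fun y => lightVector (f' y)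
  have huv (x y : Y) : ⟪u x, u y⟫ₘ = ⟪v x, v y⟫ₘ := (h x y).symm
  have hfu (y : Y) : lightVector (f y) = (l y)⁻¹ • u y := (inv_smul_smul₀ (hl y).ne' _).symm
  obtain ⟨p, q, hpq⟩ := exists_pair_ne Y
  have hu_mem : u p + u q ∈ futureCone E :=
    lightVector_add_mem_futureCone (hl p) (hl q) (hf.ne hpq)
  have hv_mem : v p + v q ∈ futureCone F := by
    simpa only [one_smul] using lightVector_add_mem_futureCone one_pos one_pos (hf'.ne hpq)
  obtain ⟨hΦ, T, hT, hTu, hTz⟩ := exists_minkowskiEquiv huv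
    (dense_span_range_of_eq_smul hfu hdense) hdense'
    (z := normalize _ hu_mem) (z' := normalize _ hv_mem) fun y => by
      simp only [vec_normalize, map_smul, smul_apply, map_add, add_apply, huv]
  obtain ⟨φ, hφ⟩ := exists_isometryEquiv_vec_eq T.toEquiv hT hTz
  refine ⟨hΦ, φ, fun y => (boundaryMap_eq_of_map_lightVector (T := T.toContinuousLinearMap)
    φ.isometry hφ (inv_pos.2 (hl y)).ne' ?_).symm⟩
  rw [hfu]
  exact (map_smul T _ _).trans (congrArg _ (hTu y))

theorem exists_isometryEquiv_of_crossRatio_eq (hY : 3 ≤ ENat.card Y) (hf : Function.Injective f)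
    (hf' : Function.Injective f') (h : ∀ a b c d, AtLeastThreeDistinct a b c d →
      boundaryCrossRatio o (f a) (f b) (f c) (f d) =
        boundaryCrossRatio o' (f' a) (f' b) (f' c) (f' d))
    (htotal : IsTotalBoundarySet (Set.range f)) (htotal' : IsTotalBoundarySet (Set.range f')) :
    Nonempty (E ≃ₗᵢ[ℝ] F) ∧ ∃ φ : Hyperboloid E ≃ᵢ Hyperboloid F,
      (∀ y, f' y = boundaryMap φ φ.isometry (f y)) ∧
        ∀ (ψ : Hyperboloid E → Hyperboloid F) (hψ : Isometry ψ),
          (∀ y, f' y = boundaryMap ψ hψ (f y)) → ψ = φ := by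
  obtain ⟨p, q, -, hpq, -, -⟩ := three_le_card_iff.1 hY
  have : Nontrivial Y := ⟨p, q, hpq⟩
  have hdense := dense_span_of_isTotal htotal
  have hdense' := dense_span_of_isTotal htotal'
  obtain ⟨l, hl, hscale⟩ := exists_lightVector_scaling hY hf hf' h
  obtain ⟨hΦ, φ, hφ⟩ := exists_isometryEquiv_of_lightVector_scaling hf hf'
    (Set.range_comp lightVector f ▸ hdense) (Set.range_comp lightVector f' ▸ hdense') hl hscale
  refine ⟨hΦ, φ, hφ, fun ψ hψ hψf => eq_of_boundaryMap_eqOn (hY.trans hf.encard_range) hdense hψ φ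
    ?_⟩
  rintro _ ⟨y, rfl⟩
  rw [← hψf, hφ]

end Comparison

section Cardinality

variable {E : Type*} [NormedAddCommGroup E] [InnerProductSpace ℝ E] {ι ι' : Type u}

theorem countable_setOf_inner_ne_zero (b : HilbertBasis ι ℝ E) (x : E) :
    {i | inner ℝ x (b i) ≠ 0}.Countable := by
  refine (b.summable_inner_mul_inner x x).countable_support.mono fun i hi => ?_
  rw [Function.mem_support, real_inner_comm x]
  exact mul_ne_zero hi hi

theorem mk_le_mk_of_hilbertBasis [Infinite ι] (b : HilbertBasis ι ℝ E)
    (b' : HilbertBasis ι' ℝ E) : Cardinal.mk ι' ≤ Cardinal.mk ι := by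
  have hcover : ⋃ i, {j | inner ℝ (b i) (b' j) ≠ 0} = Set.univ := by
    refine Set.eq_univ_of_forall fun j => ?_
    by_contra h
    simp only [Set.mem_iUnion, Set.mem_ofPred_eq, not_exists, not_not] at h
    have hrepr : b.repr (b' j) = 0 := by
      ext i
      rw [b.repr_apply_apply, h i, lp.coeFn_zero, Pi.zero_apply]
    exact b'.orthonormal.ne_zero j (b.repr.map_eq_zero_iff.1 hrepr)
  calc Cardinal.mk ι' = Cardinal.mk (⋃ i, {j | inner ℝ (b i) (b' j) ≠ 0}) := by
        rw [hcover, Cardinal.mk_univ]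
    _ ≤ Cardinal.mk ι * ⨆ i, Cardinal.mk {j | inner ℝ (b i) (b' j) ≠ 0} := Cardinal.mk_iUnion_le _
    _ ≤ Cardinal.mk ι * Cardinal.aleph0 := mul_le_mul' le_rfl (ciSup_le' fun i =>
        Cardinal.le_aleph0_iff_set_countable.2 (countable_setOf_inner_ne_zero b' (b i)))
    _ = Cardinal.mk ι := Cardinal.mul_aleph0_eq (Cardinal.aleph0_le_mk ι)

theorem finiteDimensional_of_hilbertBasis [Finite ι] (b : HilbertBasis ι ℝ E) :
    FiniteDimensional ℝ E :=
  have := Fintype.ofFinite ι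
  b.toOrthonormalBasis.toBasis.finiteDimensional_of_finite

theorem finite_of_hilbertBasis [FiniteDimensional ℝ E] (b : HilbertBasis ι ℝ E) : Finite ι :=
  b.orthonormal.linearIndependent.finite

theorem mk_eq_mk_of_hilbertBasis (b : HilbertBasis ι ℝ E) (b' : HilbertBasis ι' ℝ E) :
    Cardinal.mk ι = Cardinal.mk ι' := by
  by_cases hE : FiniteDimensional ℝ E
  · have := finite_of_hilbertBasis b
    have := finite_of_hilbertBasis b'
    have := Fintype.ofFinite ι
    have := Fintype.ofFinite ι'
    exact Cardinal.lift_inj.1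
      (mk_eq_mk_of_basis b.toOrthonormalBasis.toBasis b'.toOrthonormalBasis.toBasis)
  · have : Infinite ι := not_finite_iff_infinite.1 fun _ => hE (finiteDimensional_of_hilbertBasis b)
    have : Infinite ι' :=
      not_finite_iff_infinite.1 fun _ => hE (finiteDimensional_of_hilbertBasis b')
    exact (mk_le_mk_of_hilbertBasis b' b).antisymm (mk_le_mk_of_hilbertBasis b b')

theorem cardinal_eq_of_linearIsometryEquiv {κ κ' : Cardinal.{u}}
    (Φ : lp (fun _ : κ.out => ℝ) 2 ≃ₗᵢ[ℝ] lp (fun _ : κ'.out => ℝ) 2) : κ = κ' := by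
  simpa only [Cardinal.mk_out] using
    mk_eq_mk_of_hilbertBasis (HilbertBasis.ofRepr (LinearIsometryEquiv.refl ℝ _))
      (HilbertBasis.ofRepr Φ)

end Cardinality

section Equivariance

theorem atLeastThreeDistinct_smul {Y Γ : Type*} [Group Γ] [MulAction Γ Y] (g : Γ) {a b c d : Y}
    (h : AtLeastThreeDistinct a b c d) :
    AtLeastThreeDistinct (g • a) (g • b) (g • c) (g • d) := by
  simpa only [AtLeastThreeDistinct, (MulAction.injective g).ne_iff] using h

variable {Y : Type u} [TopologicalSpace Y] {R : Y → Y → Y → Y → ℝ≥0∞} {κ : Cardinal.{u}}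
  {f : Y → GromovBoundary (AlgHyperbolicSpace κ)}

theorem exists_isometryEquiv_of_realizesCrossRatio {κ' : Cardinal.{u}}
    {f' : Y → GromovBoundary (AlgHyperbolicSpace κ')} (hY : 3 ≤ ENat.card Y)
    (hR : IsAbstractCrossRatio R) (hf : RealizesCrossRatio R κ f)
    (hf' : RealizesCrossRatio R κ' f') :
    κ = κ' ∧ ∃ φ : AlgHyperbolicSpace κ ≃ᵢ AlgHyperbolicSpace κ',
      (∀ y, f' y = boundaryMap φ φ.isometry (f y)) ∧
        ∀ (ψ : AlgHyperbolicSpace κ → AlgHyperbolicSpace κ') (hψ : Isometry ψ),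
          (∀ y, f' y = boundaryMap ψ hψ (f y)) → ψ = φ := by
  have hf_eq := hf.crossRatio_eq Hyperboloid.origin
  have hf'_eq := hf'.crossRatio_eq Hyperboloid.origin
  obtain ⟨⟨Φ⟩, hφ⟩ := exists_isometryEquiv_of_crossRatio_eq hY
    (injective_of_crossRatio_eq hY hR hf_eq) (injective_of_crossRatio_eq hY hR hf'_eq)
    (fun a b c d hq => (hf_eq a b c d hq).trans (hf'_eq a b c d hq).symm) hf.total hf'.total
  exact ⟨cardinal_eq_of_linearIsometryEquiv Φ, hφ⟩

variable {Γ : Type v} [Group Γ] [MulAction Γ Y]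

theorem realizesCrossRatio_smul (hY : 3 ≤ ENat.card Y) (hR : IsAbstractCrossRatio R)
    (hf : RealizesCrossRatio R κ f) {g : Γ} (hg : ∀ a b c d, AtLeastThreeDistinct a b c d →
      R (g • a) (g • b) (g • c) (g • d) = R a b c d) :
    RealizesCrossRatio R κ fun y => f (g • y) := by
  have hcrossRatio (o : AlgHyperbolicSpace κ) (a b c d : Y) (hq : AtLeastThreeDistinct a b c d) :
      boundaryCrossRatio o (f (g • a)) (f (g • b)) (f (g • c)) (f (g • d)) = R a b c d := by
    rw [hf.crossRatio_eq _ _ _ _ _ (atLeastThreeDistinct_smul g hq), hg a b c d hq]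
  have hrange : Set.range (fun y => f (g • y)) = Set.range f :=
    (MulAction.surjective g).range_comp f
  exact ⟨continuous_of_crossRatio_eq hY hR (hcrossRatio Hyperboloid.origin),
    hrange.symm ▸ hf.total, hcrossRatio⟩

theorem exists_monoidHom_of_realizesCrossRatio (hY : 3 ≤ ENat.card Y)
    (hR : IsAbstractCrossRatio R) (hf : RealizesCrossRatio R κ f)
    (hΓ : ∀ (g : Γ) (a b c d : Y), AtLeastThreeDistinct a b c d →
      R (g • a) (g • b) (g • c) (g • d) = R a b c d) :
    ∃ ρ : Γ →* (AlgHyperbolicSpace κ ≃ᵢ AlgHyperbolicSpace κ),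
      ∀ (g : Γ) (y : Y), f (g • y) = boundaryMap (ρ g) (ρ g).isometry (f y) := by
  choose ρ hρ huniq using fun g => (exists_isometryEquiv_of_realizesCrossRatio hY hR hf
    (realizesCrossRatio_smul hY hR hf (hΓ g))).2
  refine ⟨MonoidHom.mk' ρ fun g g' => DFunLike.coe_injective
    (huniq (g * g') _ ((ρ g).isometry.comp (ρ g').isometry) fun y => ?_).symm, hρ⟩
  rw [GromovBoundary.boundaryMap_comp (ρ g).isometry (ρ g').isometry, ← hρ, ← hρ, mul_smul]

end Equivariance

end

theorem mainTheorem5_general {Y : Type u} [TopologicalSpace Y] {p q w : Y} (hpq : p ≠ q)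
    (hpw : p ≠ w) (hqw : q ≠ w) (R : Y → Y → Y → Y → ℝ≥0∞) (hR : IsAbstractCrossRatio R)
    (hK : IsCondNegType (crossRatioKernel R p q w)) :
    (∃ (κ : Cardinal.{u}) (f : Y → GromovBoundary (AlgHyperbolicSpace κ)),
      RealizesCrossRatio R κ f) ∧
    (∀ (κ₁ κ₂ : Cardinal.{u}) (f₁ : Y → GromovBoundary (AlgHyperbolicSpace κ₁))
      (f₂ : Y → GromovBoundary (AlgHyperbolicSpace κ₂)),
      RealizesCrossRatio R κ₁ f₁ → RealizesCrossRatio R κ₂ f₂ →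
      κ₁ = κ₂ ∧
      ∃ φ : AlgHyperbolicSpace κ₁ ≃ᵢ AlgHyperbolicSpace κ₂,
        (∀ y, f₂ y = boundaryMap φ φ.isometry (f₁ y)) ∧
        ∀ (ψ : AlgHyperbolicSpace κ₁ → AlgHyperbolicSpace κ₂) (hψ : Isometry ψ),
          (∀ y, f₂ y = boundaryMap ψ hψ (f₁ y)) → ψ = φ) ∧
    (∀ (Γ : Type v) [Group Γ] [MulAction Γ Y],
      (∀ (g : Γ) (a b c d : Y), AtLeastThreeDistinct a b c d →
        R (g • a) (g • b) (g • c) (g • d) = R a b c d) →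
      ∀ (κ : Cardinal.{u}) (f : Y → GromovBoundary (AlgHyperbolicSpace κ)),
        RealizesCrossRatio R κ f →
        ∃ ρ : Γ →* (AlgHyperbolicSpace κ ≃ᵢ AlgHyperbolicSpace κ),
          ∀ (g : Γ) (y : Y), f (g • y) = boundaryMap (ρ g) (ρ g).isometry (f y)) := by
  have hY : 3 ≤ ENat.card Y := three_le_card_iff.2 ⟨p, q, w, hpq, hpw, hqw⟩
  exact ⟨exists_realizesCrossRatio hR hpq hpw hqw hK,
    fun _ _ _ _ h₁ h₂ => exists_isometryEquiv_of_realizesCrossRatio hY hR h₁ h₂,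
    fun _ _ _ hΓ _ _ hf => exists_monoidHom_of_realizesCrossRatio hY hR hf hΓ⟩

theorem mainTheorem5 {Y : Type u} [TopologicalSpace Y] (hY : 4 ≤ ENat.card Y)
    (R : Y → Y → Y → Y → ℝ≥0∞) (hR : IsAlgebraicCrossRatio R) :
    (∃ (κ : Cardinal.{u}) (f : Y → GromovBoundary (AlgHyperbolicSpace κ)),
      RealizesCrossRatio R κ f) ∧
    (∀ (κ₁ κ₂ : Cardinal.{u}) (f₁ : Y → GromovBoundary (AlgHyperbolicSpace κ₁))
      (f₂ : Y → GromovBoundary (AlgHyperbolicSpace κ₂)),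
      RealizesCrossRatio R κ₁ f₁ → RealizesCrossRatio R κ₂ f₂ →
      κ₁ = κ₂ ∧
      ∃ φ : AlgHyperbolicSpace κ₁ ≃ᵢ AlgHyperbolicSpace κ₂,
        (∀ y, f₂ y = boundaryMap φ φ.isometry (f₁ y)) ∧
        ∀ (ψ : AlgHyperbolicSpace κ₁ → AlgHyperbolicSpace κ₂) (hψ : Isometry ψ),
          (∀ y, f₂ y = boundaryMap ψ hψ (f₁ y)) → ψ = φ) ∧
    (∀ (Γ : Type v) [Group Γ] [MulAction Γ Y],
      (∀ (g : Γ) (a b c d : Y), AtLeastThreeDistinct a b c d →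
        R (g • a) (g • b) (g • c) (g • d) = R a b c d) →
      ∀ (κ : Cardinal.{u}) (f : Y → GromovBoundary (AlgHyperbolicSpace κ)),
        RealizesCrossRatio R κ f →
        ∃ ρ : Γ →* (AlgHyperbolicSpace κ ≃ᵢ AlgHyperbolicSpace κ),
          ∀ (g : Γ) (y : Y), f (g • y) = boundaryMap (ρ g) (ρ g).isometry (f y)) := by
  obtain ⟨p, q, w, hpq, hpw, hqw⟩ := three_le_card_iff.1 (le_trans (by norm_num) hY)
  exact mainTheorem5_general hpq hpw hqw R hR.toIsAbstractCrossRatio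
    (hR.condNegType p q w hpq hpw hqw)
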